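/- **Setting.** Let $d\ge 1$, $\alpha\ge 0$, $\beta>0$, and let $C_\alpha,C_\beta,c_\mu,r_\mu>0$ and $0<\mu_-<\mu_+<\infty$. Let $(\gamma_i)_{i\ge 0}$ and $(C_{\gamma_i})_{i\ge 0}$ be sequences of positive numbers with $\gamma_0=1$. For $m\ge 0$, $\Pi_m=\Pi(\alpha,\beta,\gamma,\mu)$ is the class of tuples $(P_0,\dots,P_m)$ of probability distributions on $\mathbb R^d\times\{0,1\}$ ($P_0$ for the expert data, $P_1,\dots,P_m$ for the workers), with regression functions $\eta_i(x)=P_i(Y=1\mid X=x)$ and with marginals $P_{i,X}$ of $X$, such that for some set $\Omega\subset\mathbb R^d$: * (common support and strong density) for $0\le i\le m$, $P_{i,X}$ is absolutely continuous with respect to Lebesgue measure $\lambda$, $\operatorname{supp}P_{i,X}=\Omega$, $\lambda(\Omega\cap B(x,r))\ge c_\mu\lambda(B(x,r))$ for $0<r\le r_\mu$, $x\in\Omega$, and $\mu_-<\frac{dP_{i,X}}{d\lambda}<\mu_+$ on $\Omega$ (almost everywhere); * (smoothness) $|\eta_0(x)-\eta_0(x')|\le C_\beta\|x-x'\|^\beta$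 for $x,x'\in\Omega$; * (margin) $P_{0}(|\eta_0(X)-\tfrac12|\le t)\le C_\alpha t^\alpha$ for all $t>0$; * (relative signal exponent) for $1\le i\le m$ and $x\in\Omega$, $(\eta_i(x)-\frac12)(\eta_0(x)-\frac12)\ge 0$ and $|\eta_i(x)-\frac12|\ge C_{\gamma_i}|\eta_0(x)-\frac12|^{\gamma_i}$. For sample sizes $n_0,\dots,n_m\ge1$, let the observations $(X^i_j,Y^i_j)$, $0\le i\le m$, $1\le j\le n_i$, be independent with $(X_j^i,Y_j^i)\sim P_i$. Put $M=\max_{0\le i\le m} n_i^{\frac{2\beta+d}{2\gamma_i\beta+d}}$, $k_i=\lfloor n_iM^{-\frac{d}{2\beta+d}}\rfloor$, $w_i=M^{-\frac{\gamma_i\beta}{2\beta+d}}$. With $Y^i_{(j)}(x)$ the label of the $j$-th nearest neighbour of $x$ (Euclidean distance, ties broken by index) in the $i$-th data set, the VSNN classifier is $$\widehat f_{NN}^{VS}(x)=\mathbf 1\{\widehat\eta(x)>\tfrac12\},\qquad \widehat\eta(x)=\frac{\sum_{i=0}^m w_i\sum_{j=1}^{k_i}Y^i_{(j)}(x)}{\sum_{i=0}^m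 w_ik_i}.$$ For a classifier $f$ let $\mathcal E_0(f)=P_0(f(X)\ne Y)-\inf_g P_0(g(X)\ne Y)$ be its excess risk, the infimum being over all measurable classifiers $g$. **Theorem (Upper bound).** 1. For every $m\ge0$ there is a constant $C>0$ not depending on the $n_i$ (it may depend on $m$ and the parameters of the class) such that for all $n_0,\dots,n_m\ge1$, hence in particular as the $n_i$ grow, $$\sup_{(P_0,\dots,P_m)\in\Pi_m}\mathbb E\,\mathcal E_0(\widehat f_{NN}^{VS})\le C\Big(\max_{0\le i\le m}n_i^{\frac{2\beta+d}{2\gamma_i\beta+d}}\Big)^{-\frac{\beta(1+\alpha)}{2\beta+d}}.$$ 2. If moreover $\inf_i\gamma_i>0$ and $\inf_iC_{\gamma_i}>0$, then there is a constant $C>0$ depending neither on the $n_i$ nor on $m$ such that for every $m$ the same bound holds whenever $\min_{0\le i\le m}n_i\ge N_m$, where $N_m$ depends only on $m$ and the parameters of the class. -/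

import Mathlib

open MeasureTheory
open scoped ENNReal

namespace VSNN

/-- The feature space `ℝ^d` with its Euclidean norm. -/
abbrev Feature (d : ℕ) : Type := EuclideanSpace ℝ (Fin d)

/-- A labelled observation `(X, Y)`; the label `1` is `true` and the label `0` is `false`. -/
abbrev Obs (d : ℕ) : Type := Feature d × Bool

/-- The numerical value in `{0, 1}` of a label. -/
def labelVal (y : Bool) : ℝ := if y then 1 else 0

/-- The marginal distribution of the feature `X`. -/
noncomputable def marginal {d : ℕ} (P : ProbabilityMeasure (Obs d)) : Measure (Feature d) :=
  (P : Measure (Obs d)).map Prod.fst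

/-- `η` is a version of the regression function `x ↦ P(Y = 1 | X = x)`. -/
structure IsRegressionFunction {d : ℕ} (P : ProbabilityMeasure (Obs d))
    (η : Feature d → ℝ) : Prop where
  measurable : Measurable η
  mem_Icc : ∀ x, η x ∈ Set.Icc (0 : ℝ) 1
  condProb : ∀ A : Set (Feature d), MeasurableSet A →
    (P : Measure (Obs d)) (A ×ˢ {true}) = ∫⁻ x in A, ENNReal.ofReal (η x) ∂(marginal P)

/-- The strong density condition with parameters `μlo, μhi, cμ, rμ` for a distribution `Q`
on `ℝ^d` with support `Ω`. The Radon-Nikodym density is determined up to Lebesgue-null sets,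
so its bounds are required almost everywhere on `Ω`. -/
structure StrongDensity {d : ℕ} (μlo μhi cμ rμ : ℝ) (Ω : Set (Feature d))
    (Q : Measure (Feature d)) : Prop where
  absCont : Q ≪ volume
  support_eq : Q.support = Ω
  regular : ∀ r : ℝ, 0 < r → r ≤ rμ → ∀ x ∈ Ω,
    ENNReal.ofReal cμ * volume (Metric.ball x r) ≤ volume (Ω ∩ Metric.ball x r)
  density : ∀ᵐ x ∂(volume.restrict Ω),
    ENNReal.ofReal μlo < Q.rnDeriv volume x ∧ Q.rnDeriv volume x < ENNReal.ofReal μhi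

/-- The class `Π(α, β, γ, μ)` of tuples `(P_0, …, P_m)`; `P_0` is the distribution of the
expert (ground truth) data and `P_1, …, P_m` are the distributions of the workers' data. -/
def distClass {d : ℕ} (α Cα β Cβ μlo μhi cμ rμ : ℝ) {m : ℕ} (γ Cγ : Fin (m + 1) → ℝ) :
    Set (Fin (m + 1) → ProbabilityMeasure (Obs d)) :=
  {P | ∃ (η : Fin (m + 1) → Feature d → ℝ) (Ω : Set (Feature d)),
    (∀ i, IsRegressionFunction (P i) (η i)) ∧
    -- common support and strong density
    (∀ i, StrongDensity μlo μhi cμ rμ Ω (marginal (P i))) ∧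
    -- smoothness of the ground truth regression function
    (∀ x ∈ Ω, ∀ x' ∈ Ω, |η 0 x - η 0 x'| ≤ Cβ * ‖x - x'‖ ^ β) ∧
    -- margin condition
    (∀ t : ℝ, 0 < t →
      marginal (P 0) {x | |η 0 x - 1 / 2| ≤ t} ≤ ENNReal.ofReal (Cα * t ^ α)) ∧
    -- relative signal exponents of the workers
    (∀ i, i ≠ 0 → ∀ x ∈ Ω,
      0 ≤ (η i x - 1 / 2) * (η 0 x - 1 / 2) ∧
      Cγ i * |η 0 x - 1 / 2| ^ γ i ≤ |η i x - 1 / 2|)}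

/-- The misclassification probability of a classifier `f` when `(X, Y) ∼ P`. -/
noncomputable def risk {d : ℕ} (P : ProbabilityMeasure (Obs d)) (f : Feature d → Bool) : ℝ≥0∞ :=
  (P : Measure (Obs d)) {z | f z.1 ≠ z.2}

/-- The Bayes risk: the smallest risk of a measurable classifier. -/
noncomputable def bayesRisk {d : ℕ} (P : ProbabilityMeasure (Obs d)) : ℝ≥0∞ :=
  ⨅ g : {g : Feature d → Bool // Measurable g}, risk P g.1

/-- The excess risk (nonnegative, as the Bayes risk is the minimum over all classifiers). -/
noncomputable def excessRisk {d : ℕ} (P : ProbabilityMeasure (Obs d))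
    (f : Feature d → Bool) : ℝ≥0∞ :=
  risk P f - bayesRisk P

/-- `maxEff d β γ n = max_i n_i ^ ((2β + d) / (2 γ_i β + d))`. -/
noncomputable def maxEff (d : ℕ) (β : ℝ) {m : ℕ} (γ : Fin (m + 1) → ℝ)
    (n : Fin (m + 1) → ℕ) : ℝ :=
  Finset.univ.sup' Finset.univ_nonempty
    fun i => (n i : ℝ) ^ ((2 * β + d) / (2 * γ i * β + d))

/-- The number of neighbours `k_i` used in the `i`-th data set. -/
noncomputable def numNeighbors (d : ℕ) (β : ℝ) {m : ℕ} (γ : Fin (m + 1) → ℝ)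
    (n : Fin (m + 1) → ℕ) (i : Fin (m + 1)) : ℕ :=
  ⌊(n i : ℝ) * maxEff d β γ n ^ (-((d : ℝ) / (2 * β + d)))⌋₊

/-- The weight `w_i` of the `i`-th data set. -/
noncomputable def weight (d : ℕ) (β : ℝ) {m : ℕ} (γ : Fin (m + 1) → ℝ)
    (n : Fin (m + 1) → ℕ) (i : Fin (m + 1)) : ℝ :=
  maxEff d β γ n ^ (-(γ i * β / (2 * β + d)))

/-- The label `Y_(j)(x)` of the `j`-th nearest data point to `x` (counted from `j = 0`); points
at equal distance from `x` are ordered by their index. -/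
noncomputable def nnLabel {d N : ℕ} (s : Fin N → Obs d) (x : Feature d) (j : Fin N) : Bool :=
  (s (Tuple.sort (fun l => dist (s l).1 x) j)).2

/-- All data: `n_i` labelled observations in the `i`-th data set, for `i = 0, …, m`. -/
abbrev Sample (d : ℕ) {m : ℕ} (n : Fin (m + 1) → ℕ) : Type :=
  (i : Fin (m + 1)) → Fin (n i) → Obs d

/-- The weighted nearest neighbour estimator
`(∑_i w_i ∑_{j ≤ k_i} Y^i_(j)(x)) / ∑_i w_i k_i` of the regression function. -/
noncomputable def etaHat {d : ℕ} (β : ℝ) {m : ℕ} (γ : Fin (m + 1) → ℝ) {n : Fin (m + 1) → ℕ}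
    (s : Sample d n) (x : Feature d) : ℝ :=
  (∑ i, weight d β γ n i *
      ∑ j : Fin (n i), if (j : ℕ) < numNeighbors d β γ n i then labelVal (nnLabel (s i) x j) else 0) /
    ∑ i, weight d β γ n i * (numNeighbors d β γ n i : ℝ)

open Classical in
/-- The voting-second nearest neighbour classifier, the plug-in rule `1{etaHat > 1/2}`. -/
noncomputable def classifier {d : ℕ} (β : ℝ) {m : ℕ} (γ : Fin (m + 1) → ℝ)
    {n : Fin (m + 1) → ℕ} (s : Sample d n) : Feature d → Bool :=
  fun x => decide (1 / 2 < etaHat β γ s x)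

/-- The law of the data: all observations are independent, those of the `i`-th data set
have distribution `P_i`. -/
noncomputable def sampleLaw {d m : ℕ} (P : Fin (m + 1) → ProbabilityMeasure (Obs d))
    (n : Fin (m + 1) → ℕ) : Measure (Sample d n) :=
  Measure.pi fun i => Measure.pi fun _ : Fin (n i) => (P i : Measure (Obs d))

/-- The expected excess risk, with respect to `P_0`, of the classifier built from the data. -/
noncomputable def expectedExcessRisk {d : ℕ} (β : ℝ) {m : ℕ} (γ : Fin (m + 1) → ℝ)
    (n : Fin (m + 1) → ℕ) (P : Fin (m + 1) → ProbabilityMeasure (Obs d)) : ℝ≥0∞ :=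
  ∫⁻ s : Sample d n, excessRisk (P 0) (classifier β γ s) ∂(sampleLaw P n)

end VSNN

/-! Put `δ = M ^ (-β / (2β + d))` (`rate`). Then `w_i = δ ^ γ_i` and `k_i` is the integer part of
`n_i δ ^ (d / β)`: each data set consults neighbours at distance of order `δ ^ (1 / β)`, over which
`η 0` varies by order `δ`, and each worker is weighted by the signal `δ ^ γ_i` guaranteed, up to a
constant, where `|η 0 - 1/2|` is `δ`. With these weights the variance proxy of the vote is of order
`S = ∑ w_i² k_i`, and its mean signal is at least of that order. Moreover `S ≥ 1/2`, because `n_i δ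
^ (d / β) = w_i⁻²` for the data set attaining the maximum `M` (`half_le_sum_weight`).

At a point with `|η 0 - 1/2| = 2δv`, Hoeffding's inequality conditionally on the features bounds the
error by `exp (-(c²/4) v ^ (2c))`, provided that the neighbours lie in a ball of radius of order
`(δv) ^ (1 / β)`; by Chernoff's bound this fails for data set `i` with probability at most `exp
(-k_i a v ^ (d / β))`. The sum (`exists_pointwise_bound`) decays faster than any power of `v`, so
integrating it against the margin condition (`lintegral_margin_le`) gives `δ ^ (1 + α)`.

The number `m` enters through the union bound over data sets. A cutoff `L` controls it: data sets
with at most `L` neighbours are given up and counted with the worst conditional mean, which costs at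
most order `(m + 1) L δ ^ c`, while the others fail with total probability at most `(m + 1) exp (-(L
+ 1) y)`, where `y = a v ^ (d / β)`. For `L = 0` nothing is lost but the factor `m + 1` stays; for
`L = m` the factor is absorbed by the exponential, provided that `δ` is small, hence the large
sample sizes in the second claim. -/

namespace VSNN

open ProbabilityTheory Set

/-! ### Labels driven by independent uniform variables -/

/-- Coordinatewise version of a family of random maps driven by independent pairs. -/
theorem pi_eq_map_prod_pi {ι : Type*} [Fintype ι] {A B Y : ι → Type*}
    [∀ i, MeasurableSpace (A i)] [∀ i, MeasurableSpace (B i)] [∀ i, MeasurableSpace (Y i)]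
    (μ : ∀ i, Measure (A i)) (ν : ∀ i, Measure (B i))
    [∀ i, IsProbabilityMeasure (μ i)] [∀ i, IsProbabilityMeasure (ν i)]
    (φ : ∀ i, A i × B i → Y i) (hφ : ∀ i, Measurable (φ i)) :
    Measure.pi (fun i => ((μ i).prod (ν i)).map (φ i)) =
      ((Measure.pi μ).prod (Measure.pi ν)).map (fun z i => φ i (z.1 i, z.2 i)) := by
  -- Only the regrouping of coordinates needs proof: both measures agree on products of rectangles,
  -- and rectangles form a generating π-system in each factor.
  have hswap : Measure.pi (fun i => (μ i).prod (ν i)) =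
      ((Measure.pi μ).prod (Measure.pi ν)).map (fun z i => (z.1 i, z.2 i)) := by
    refine Measure.pi_eq_generateFrom (C := fun i => image2 (· ×ˢ ·) {s : Set (A i) | MeasurableSet s}
      {t : Set (B i) | MeasurableSet t}) (fun i => generateFrom_prod) (fun i => isPiSystem_prod)
      (fun i => ?_) ?_
    · exact ⟨fun _ => univ, fun _ => ⟨univ, MeasurableSet.univ, univ, MeasurableSet.univ, by simp⟩,
        fun _ => measure_lt_top _ _, by simp [iUnion_const]⟩
    · intro s hs
      choose a ha b hb hab using hs
      have hs' : ∀ i, s i = a i ×ˢ b i := fun i => (hab i).symm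
      have hm : MeasurableSet (univ.pi s) :=
        MeasurableSet.univ_pi fun i => by rw [hs']; exact (ha i).prod (hb i)
      rw [Measure.map_apply (by fun_prop) hm]
      have : (fun (z : (∀ i, A i) × (∀ i, B i)) i => (z.1 i, z.2 i)) ⁻¹' univ.pi s =
          (univ.pi a) ×ˢ (univ.pi b) := by
        ext z; simp [Set.mem_pi, hs', forall_and]
      rw [this, Measure.prod_prod, Measure.pi_pi, Measure.pi_pi, ← Finset.prod_mul_distrib]
      simp [hs', Measure.prod_prod]
  have := fun i => Measure.isProbabilityMeasure_map (μ := (μ i).prod (ν i)) (hφ i).aemeasurable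
  rw [← Measure.pi_map_pi (fun i => (hφ i).aemeasurable), hswap,
    Measure.map_map (by fun_prop) (by fun_prop)]
  rfl

/-- The uniform distribution on the unit interval. -/
noncomputable def unif : Measure ℝ := volume.restrict (Icc 0 1)

instance : IsProbabilityMeasure unif := ⟨by simp [unif]⟩

theorem unif_lt {p : ℝ} (hp : p ∈ Icc (0 : ℝ) 1) : unif {u | u < p} = ENNReal.ofReal p := by
  have : {u : ℝ | u < p} ∩ Icc 0 1 = Ico 0 p := by
    ext u; simp only [mem_inter_iff, mem_ofPred_eq, mem_Icc, mem_Ico]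
    constructor
    · rintro ⟨h1, h2, -⟩; exact ⟨h2, h1⟩
    · rintro ⟨h1, h2⟩; exact ⟨h2, h1, h2.le.trans hp.2⟩
  rw [unif, Measure.restrict_apply (show MeasurableSet {u : ℝ | u < p} from measurableSet_Iio), this, Real.volume_Ico, sub_zero]

theorem unif_not_lt {p : ℝ} (hp : p ∈ Icc (0 : ℝ) 1) :
    unif {u | ¬ u < p} = ENNReal.ofReal (1 - p) := by
  have h := measure_compl (μ := unif) (s := {u | u < p}) measurableSet_Iio (measure_ne_top _ _)
  rw [unif_lt hp, measure_univ] at h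
  rw [ENNReal.ofReal_sub _ hp.1, ENNReal.ofReal_one, ← h]
  rfl

variable {d : ℕ}

/-- An observation with feature `x` whose label is drawn by means of the uniform variable `u`. -/
noncomputable def drawObs (η : Feature d → ℝ) (z : Feature d × ℝ) : Obs d :=
  (z.1, decide (z.2 < η z.1))

theorem measurable_drawObs {η : Feature d → ℝ} (hη : Measurable η) : Measurable (drawObs η) := by
  refine measurable_fst.prodMk ?_
  refine measurable_to_bool ?_
  convert measurableSet_lt measurable_snd (hη.comp measurable_fst) using 1
  ext z; simp

instance (P : ProbabilityMeasure (Obs d)) : IsProbabilityMeasure (marginal P) :=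
  Measure.isProbabilityMeasure_map measurable_fst.aemeasurable

theorem IsRegressionFunction.apply_false {P : ProbabilityMeasure (Obs d)} {η : Feature d → ℝ}
    (h : IsRegressionFunction P η) {A : Set (Feature d)} (hA : MeasurableSet A) :
    (P : Measure (Obs d)) (A ×ˢ {false}) = ∫⁻ x in A, ENNReal.ofReal (1 - η x) ∂(marginal P) := by
  have hsplit : (P : Measure (Obs d)) (A ×ˢ {true}) + (P : Measure (Obs d)) (A ×ˢ {false}) =
      marginal P A := by
    rw [← measure_union _ (hA.prod (measurableSet_singleton _)), marginal,
      Measure.map_apply measurable_fst hA]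
    · congr 1
      ext ⟨x, b⟩
      cases b <;> simp
    · rw [Set.disjoint_left]
      rintro ⟨x, b⟩ h1 h2
      simp_all
  have hint : ∫⁻ x in A, ENNReal.ofReal (η x) ∂(marginal P) +
      ∫⁻ x in A, ENNReal.ofReal (1 - η x) ∂(marginal P) = marginal P A := by
    rw [← lintegral_add_left h.measurable.ennreal_ofReal]
    have : ∀ x, ENNReal.ofReal (η x) + ENNReal.ofReal (1 - η x) = 1 := fun x => by
      rw [← ENNReal.ofReal_add (h.mem_Icc x).1 (by linarith [(h.mem_Icc x).2])]
      simp
    simp [this]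
  rw [h.condProb A hA, ← hint] at hsplit
  refine (ENNReal.add_right_inj ?_).1 hsplit
  rw [← h.condProb A hA]
  exact measure_ne_top _ _

/-- The label takes two values, so sets `A ×ˢ {b}` suffice, and there `unif {u | u < η x} = η x`.
This makes the labels independent given the features without conditional distributions: fixing the
features becomes Fubini on a product. -/
theorem IsRegressionFunction.eq_map_drawObs {P : ProbabilityMeasure (Obs d)} {η : Feature d → ℝ}
    (h : IsRegressionFunction P η) :
    (P : Measure (Obs d)) = ((marginal P).prod unif).map (drawObs η) := by
  have hm := measurable_drawObs h.measurable
  have := Measure.isProbabilityMeasure_map (μ := (marginal P).prod unif) hm.aemeasurable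
  have key : ∀ (A : Set (Feature d)) (b : Bool), MeasurableSet A →
      (P : Measure (Obs d)) (A ×ˢ {b}) = ((marginal P).prod unif).map (drawObs η) (A ×ˢ {b}) := by
    intro A b hA
    have hAb : MeasurableSet (A ×ˢ {b}) := hA.prod (measurableSet_singleton b)
    rw [Measure.map_apply hm hAb, Measure.prod_apply (hm hAb)]
    have hx : ∀ x, unif (Prod.mk x ⁻¹' (drawObs η ⁻¹' (A ×ˢ {b}))) =
        A.indicator (fun x => if b then ENNReal.ofReal (η x) else ENNReal.ofReal (1 - η x)) x := by
      intro x
      by_cases hxA : x ∈ A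
      · cases b
        · simp only [indicator_of_mem hxA, Bool.false_eq_true, if_false]
          rw [← unif_not_lt (h.mem_Icc x)]
          congr 1; ext u; simp [drawObs, hxA]
        · simp only [indicator_of_mem hxA, if_true]
          rw [← unif_lt (h.mem_Icc x)]
          congr 1; ext u; simp [drawObs, hxA]
      · rw [indicator_of_notMem hxA]
        convert measure_empty (μ := unif)
        ext u; simp [drawObs, hxA]
    simp_rw [hx]
    rw [lintegral_indicator hA]
    cases b
    · simpa using h.apply_false hA
    · simpa using h.condProb A hA
  ext S hS
  have hS' : S = ((fun x => (x, true)) ⁻¹' S) ×ˢ {true} ∪ ((fun x => (x, false)) ⁻¹' S) ×ˢ {false} := by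
    ext ⟨x, b⟩; cases b <;> simp
  have hd : Disjoint (((fun x : Feature d => (x, true)) ⁻¹' S) ×ˢ {true})
      (((fun x => (x, false)) ⁻¹' S) ×ˢ {false}) := by
    rw [Set.disjoint_left]
    rintro ⟨x, b⟩ ⟨-, h1⟩ ⟨-, h2⟩
    simp only [mem_singleton_iff] at h1 h2
    exact Bool.noConfusion (h1.symm.trans h2)
  have m1 : MeasurableSet ((fun x : Feature d => (x, true)) ⁻¹' S) := hS.preimage (by fun_prop)
  have m2 : MeasurableSet ((fun x : Feature d => (x, false)) ⁻¹' S) := hS.preimage (by fun_prop)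
  rw [hS', measure_union hd (m2.prod (measurableSet_singleton _)),
    measure_union hd (m2.prod (measurableSet_singleton _)), key _ _ m1, key _ _ m2]

/-! ### Excess risk through the regression function -/

theorem IsRegressionFunction.risk_eq {P : ProbabilityMeasure (Obs d)} {η : Feature d → ℝ}
    (h : IsRegressionFunction P η) {f : Feature d → Bool} (hf : Measurable f) :
    risk P f = ∫⁻ x, (if f x then ENNReal.ofReal (1 - η x) else ENNReal.ofReal (η x))
      ∂(marginal P) := by
  have hm := measurable_drawObs h.measurable
  have hS : MeasurableSet {z : Obs d | f z.1 ≠ z.2} :=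
    (measurableSet_eq_fun (hf.comp measurable_fst) measurable_snd).compl
  rw [risk, h.eq_map_drawObs, Measure.map_apply hm hS, Measure.prod_apply (hm hS)]
  refine lintegral_congr fun x => ?_
  cases hfx : f x
  · simp only [Bool.false_eq_true, if_false]
    rw [← unif_lt (h.mem_Icc x)]
    congr 1; ext u; simp [drawObs, hfx]
  · simp only [if_true]
    rw [← unif_not_lt (h.mem_Icc x)]
    congr 1; ext u; simp [drawObs, hfx]

/-- `f` disagrees at `x` with the Bayes rule of a regression function with value `p` at `x`. -/
def Disagree (y : Bool) (p : ℝ) : Prop := (y = true ∧ p < 1 / 2) ∨ (y = false ∧ 1 / 2 < p)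

theorem measurableSet_disagree {Ω : Type*} [MeasurableSpace Ω] {f : Ω → Bool} {g : Ω → ℝ}
    (hf : Measurable f) (hg : Measurable g) : MeasurableSet {x | Disagree (f x) (g x)} := by
  unfold Disagree
  have h1 : MeasurableSet {x | f x = true} := hf (measurableSet_singleton true)
  have h2 : MeasurableSet {x | f x = false} := hf (measurableSet_singleton false)
  exact (h1.inter (measurableSet_lt hg measurable_const)).union
    (h2.inter (measurableSet_lt measurable_const hg))

/-- Pointwise, any label costs at least `min η (1 - η)`, and exactly `2 |η - 1/2|` more if it is the
wrong one; at `η = 1/2` no label is wrong. -/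
theorem IsRegressionFunction.excessRisk_le {P : ProbabilityMeasure (Obs d)} {η : Feature d → ℝ}
    (h : IsRegressionFunction P η) {f : Feature d → Bool} (hf : Measurable f) :
    excessRisk P f ≤ ∫⁻ x, {x | Disagree (f x) (η x)}.indicator
      (fun x => ENNReal.ofReal (2 * |η x - 1 / 2|)) x ∂(marginal P) := by
  have hη := h.measurable
  set b : Feature d → ℝ≥0∞ := fun x => ENNReal.ofReal (min (η x) (1 - η x)) with hb
  have hbayes : ∫⁻ x, b x ∂(marginal P) ≤ bayesRisk P := by
    refine le_iInf fun g => ?_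
    rw [h.risk_eq g.2]
    refine lintegral_mono fun x => ?_
    dsimp only [b]
    split_ifs
    · exact ENNReal.ofReal_le_ofReal (min_le_right _ _)
    · exact ENNReal.ofReal_le_ofReal (min_le_left _ _)
  rw [excessRisk, tsub_le_iff_right]
  refine le_trans ?_ (add_le_add_right hbayes _)
  rw [← lintegral_add_right _ (by fun_prop), h.risk_eq hf]
  refine lintegral_mono fun x => ?_
  have h0 := (h.mem_Icc x).1
  have h1 := (h.mem_Icc x).2
  by_cases hx : Disagree (f x) (η x)
  · rw [indicator_of_mem (by exact hx)]
    dsimp only [b]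
    rw [← ENNReal.ofReal_add (by positivity) (le_min h0 (by linarith))]
    rcases hx with ⟨hfx, hlt⟩ | ⟨hfx, hlt⟩
    · simp only [hfx, if_true]
      refine ENNReal.ofReal_le_ofReal ?_
      rw [abs_of_neg (by linarith), min_eq_left (by linarith)]
      linarith
    · simp only [hfx, Bool.false_eq_true, if_false]
      refine ENNReal.ofReal_le_ofReal ?_
      rw [abs_of_pos (by linarith), min_eq_right (by linarith)]
      linarith
  · rw [indicator_of_notMem (by exact hx), zero_add]
    dsimp only [b]
    cases hfx : f x
    · have : ¬ 1 / 2 < η x := fun hh => hx (Or.inr ⟨hfx, hh⟩)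
      simp only [Bool.false_eq_true, if_false]
      exact ENNReal.ofReal_le_ofReal (le_min le_rfl (by linarith))
    · have : ¬ η x < 1 / 2 := fun hh => hx (Or.inl ⟨hfx, hh⟩)
      simp only [if_true]
      exact ENNReal.ofReal_le_ofReal (le_min (by linarith) le_rfl)

/-! ### Concentration inequalities -/

/-- **Hoeffding's inequality** for a weighted sum of independent Bernoulli variables that are
indexed by a dependent pair. -/
theorem hoeffding_bernoulli {ι : Type*} [Fintype ι] {κ : ι → Type*} [∀ i, Fintype (κ i)]
    (p a : ∀ i, κ i → ℝ) (hp : ∀ i l, p i l ∈ Icc (0 : ℝ) 1) {D : ℝ} (hD : 0 ≤ D) :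
    Measure.pi (fun i => Measure.pi fun _ : κ i => unif)
      {u | ∑ i, ∑ l, a i l * ((if u i l < p i l then 1 else 0) - p i l) ≤ -D} ≤
    ENNReal.ofReal (Real.exp (-(2 * D ^ 2 / ∑ i, ∑ l, a i l ^ 2))) := by
  set ν : Measure (∀ i, κ i → ℝ) := Measure.pi (fun i => Measure.pi fun _ : κ i => unif) with hν
  have hmeas : ∀ (i : ι) (l : κ i), Measurable fun v : ℝ => -a i l * ((if v < p i l then 1 else 0) - p i l) := by
    intro i l
    refine Measurable.const_mul (Measurable.sub_const ?_ _) _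
    exact Measurable.ite measurableSet_Iio measurable_const measurable_const
  have hind : iIndepFun (fun (q : (i : ι) × κ i) (u : ∀ i, κ i → ℝ) =>
      -a q.1 q.2 * ((if u q.1 q.2 < p q.1 q.2 then 1 else 0) - p q.1 q.2)) ν := by
    have := iIndepFun_uncurry_infinitePi (Ω := fun (i : ι) (_ : κ i) => ℝ)
      (X := fun i l v => -a i l * ((if v < p i l then 1 else 0) - p i l))
      (fun _ _ => unif) hmeas
    simpa only [Measure.infinitePi_eq_pi] using this
  have hsub : ∀ q : (i : ι) × κ i, HasSubgaussianMGF (fun u : ∀ i, κ i → ℝ =>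
      -a q.1 q.2 * ((if u q.1 q.2 < p q.1 q.2 then 1 else 0) - p q.1 q.2))
      ((‖a q.1 q.2‖₊ / 2) ^ 2) ν := by
    rintro ⟨i, l⟩
    have hev : MeasurePreserving (fun u : ∀ i, κ i → ℝ => u i l) ν unif :=
      (measurePreserving_eval (fun _ : κ i => unif) l).comp
        (measurePreserving_eval (fun i => Measure.pi fun _ : κ i => unif) i)
    refine HasSubgaussianMGF.of_map (Y := fun u : ∀ i, κ i → ℝ => u i l)
      (X := fun v : ℝ => -a i l * ((if v < p i l then 1 else 0) - p i l))
      hev.measurable.aemeasurable ?_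
    rw [hev.map_eq]
    have hite : Measurable fun v : ℝ => if v < p i l then (1 : ℝ) else 0 :=
      Measurable.ite measurableSet_Iio measurable_const measurable_const
    have h0 := hasSubgaussianMGF_of_mem_Icc (μ := unif) (a := 0) (b := 1) hite.aemeasurable
      (ae_of_all _ fun v => by split_ifs <;> simp)
    have hmean : unif[fun v : ℝ => if v < p i l then (1 : ℝ) else 0] = p i l := by
      have : (fun v : ℝ => if v < p i l then (1 : ℝ) else 0) = indicator {v | v < p i l} 1 := by
        ext v; simp [indicator]
      rw [this, integral_indicator_one (show MeasurableSet {v | v < p i l} from measurableSet_Iio), Measure.real, unif_lt (hp i l),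
        ENNReal.toReal_ofReal (hp i l).1]
    rw [hmean] at h0
    have h1 := h0.const_mul (-a i l)
    have hc : @HMul.hMul NNReal NNReal NNReal _ ⟨(-a i l) ^ 2, sq_nonneg _⟩ ((‖(1 : ℝ) - 0‖₊ / 2) ^ 2) =
        (‖a i l‖₊ / 2) ^ 2 := by
      apply NNReal.eq
      change (-a i l) ^ 2 * (((‖(1 : ℝ) - 0‖₊ / 2) ^ 2 : NNReal) : ℝ) = _
      push_cast
      simp only [Real.norm_eq_abs, div_pow, sq_abs]
      ring
    rwa [hc] at h1
  have hfin := HasSubgaussianMGF.measure_sum_ge_le_of_iIndepFun hind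
    (s := Finset.univ) (fun q _ => hsub q) hD
  rw [← ENNReal.ofReal_toReal (measure_ne_top ν _)]
  refine ENNReal.ofReal_le_ofReal ?_
  convert hfin using 2
  · rw [Measure.real]
    congr 2
    ext u
    simp only [mem_ofPred_eq, Fintype.sum_sigma, neg_mul, Finset.sum_neg_distrib]
    constructor <;> intro h <;> linarith
  · push_cast
    rw [Fintype.sum_sigma]
    simp only [Real.norm_eq_abs, div_pow, sq_abs, ← Finset.sum_div]
    generalize ∑ i, ∑ l, a i l ^ 2 = V
    -- For `V = 0` division by zero makes both exponents `0`, and the bound is the trivial `1`.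
    rcases eq_or_ne V 0 with rfl | hV
    · simp
    · field_simp

/-- Chernoff's bound for the lower tail of the number of sample points in a set. -/
theorem chernoff_lower {E : Type*} [MeasurableSpace E] (μ : Measure E) [IsProbabilityMeasure μ]
    {B : Set E} (hB : MeasurableSet B) {q : ℝ} (hq : ENNReal.ofReal q ≤ μ B) (N : ℕ) (k : ℝ)
    [DecidablePred (· ∈ B)] :
    Measure.pi (fun _ : Fin N => μ) {s | ((Finset.univ.filter fun l => s l ∈ B).card : ℝ) < k} ≤
      ENNReal.ofReal (Real.exp (k - N * q / 2)) := by
  set ν := Measure.pi (fun _ : Fin N => μ)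
  -- The product of `g` over the sample is `exp (-count)`, to which Markov's inequality applies at
  -- level `exp (-k)`. Its factors have mean `1 - (1 - 1/e) μ(B) ≤ 1 - q/2 ≤ exp (-q/2)`, since `e ≥
  -- 2`.
  set g : E → ℝ := fun y => if y ∈ B then Real.exp (-1) else 1 with hg
  have hgm : Measurable g := Measurable.ite hB measurable_const measurable_const
  have hg0 : ∀ y, 0 ≤ g y := fun y => by simp only [hg]; split_ifs <;> positivity
  have hg1 : ∀ y, g y ≤ 1 := fun y => by
    simp only [hg]; split_ifs
    · exact Real.exp_le_one_iff.2 (by norm_num)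
    · exact le_rfl
  have hint : ∫ y, g y ∂μ ≤ Real.exp (-(q / 2)) := by
    have hgi : g = fun y => 1 - (1 - Real.exp (-1)) * B.indicator 1 y := by
      ext y; by_cases hy : y ∈ B <;> simp [hg, hy]
    have hqB : q ≤ μ.real B := (ENNReal.ofReal_le_iff_le_toReal (measure_ne_top _ _)).1 hq
    have he : Real.exp (-1) ≤ 1 / 2 := by
      have := Real.add_one_le_exp 1
      rw [Real.exp_neg, inv_le_comm₀ (Real.exp_pos _) (by norm_num)]
      linarith
    have hi : Integrable (B.indicator (1 : E → ℝ)) μ := (integrable_const (1 : ℝ)).indicator hB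
    simp only [hgi]
    rw [integral_sub (integrable_const _) (hi.const_mul _), integral_const_mul,
      integral_indicator_one hB]
    have := Real.add_one_le_exp (-(q / 2))
    have h0 : 0 ≤ μ.real B := measureReal_nonneg
    simp only [integral_const, probReal_univ, smul_eq_mul, mul_one]
    nlinarith
  have hprod : ∫ s, ∏ l, g (s l) ∂ν ≤ Real.exp (-(N * q / 2)) := by
    rw [integral_fintype_prod_eq_prod (fun _ : Fin N => g)]
    calc ∏ _l : Fin N, ∫ y, g y ∂μ ≤ ∏ _l : Fin N, Real.exp (-(q / 2)) :=
          Finset.prod_le_prod (fun _ _ => integral_nonneg hg0) fun _ _ => hint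
      _ = Real.exp (-(N * q / 2)) := by
          rw [Finset.prod_const, Finset.card_univ, Fintype.card_fin, ← Real.exp_nat_mul]
          congr 1; ring
  have hGm : Measurable fun s : Fin N → E => ∏ l, g (s l) :=
    Finset.measurable_prod _ fun l _ => hgm.comp (measurable_pi_apply l)
  have hGi : Integrable (fun s : Fin N → E => ∏ l, g (s l)) ν := by
    refine Integrable.of_mem_Icc 0 1 hGm.aemeasurable (ae_of_all _ fun s => ⟨?_, ?_⟩)
    · exact Finset.prod_nonneg fun l _ => hg0 _
    · exact Finset.prod_le_one (fun l _ => hg0 _) fun l _ => hg1 _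
  have hmark := mul_meas_ge_le_integral_of_nonneg (μ := ν)
    (ae_of_all _ fun s => Finset.prod_nonneg fun l _ => hg0 (s l)) hGi (Real.exp (-k))
  have hsub : {s : Fin N → E | ((Finset.univ.filter fun l => s l ∈ B).card : ℝ) < k} ⊆
      {s | Real.exp (-k) ≤ ∏ l, g (s l)} := by
    intro s hs
    simp only [mem_ofPred_eq] at hs ⊢
    simp only [hg]
    rw [Finset.prod_ite, Finset.prod_const_one, mul_one, Finset.prod_const, ← Real.exp_nat_mul]
    exact Real.exp_le_exp.2 (by linarith)
  refine (measure_mono hsub).trans ?_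
  rw [← ENNReal.ofReal_toReal (measure_ne_top ν _)]
  refine ENNReal.ofReal_le_ofReal ?_
  have h2 := hmark.trans hprod
  rw [sub_eq_add_neg, Real.exp_add]
  rwa [Real.exp_neg k, inv_mul_le_iff₀ (Real.exp_pos _), ← Real.exp_neg] at h2

/-! ### Mass of small balls -/

/-- Under the strong density condition a ball of bounded radius around a point of the support has
mass at least of the order of its volume. -/
theorem exists_ball_mass_lower {μlo μhi cμ rμ : ℝ} (hμlo : 0 < μlo) (hcμ : 0 < cμ)
    (hrμ : 0 < rμ) {R : ℝ} (hR : 0 < R) :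
    ∃ c : ℝ, 0 < c ∧ ∀ (Ω : Set (Feature d)) (Q : Measure (Feature d)) [IsProbabilityMeasure Q],
      StrongDensity μlo μhi cμ rμ Ω Q → ∀ x ∈ Ω, ∀ r, 0 < r → r ≤ R →
        ENNReal.ofReal (c * r ^ d) ≤ Q (Metric.ball x r) := by
  have hv0 : 0 < volume (Metric.ball (0 : Feature d) 1) := Metric.measure_ball_pos _ _ one_pos
  have hvt : volume (Metric.ball (0 : Feature d) 1) ≠ ⊤ := measure_ball_lt_top.ne
  set v := (volume (Metric.ball (0 : Feature d) 1)).toReal with hv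
  have hvpos : 0 < v := ENNReal.toReal_pos hv0.ne' hvt
  -- Regularity is given only up to radius `rμ`; shrinking every ball by `θ` brings radii up to `R`
  -- into that range at the price of `θ ^ d`.
  set θ := min 1 (rμ / R) with hθ
  have hθ0 : 0 < θ := lt_min one_pos (by positivity)
  refine ⟨μlo * cμ * v * θ ^ d, by positivity, fun Ω Q _ hQ x hx r hr hrR => ?_⟩
  have hr' : 0 < θ * r := by positivity
  have hr1 : θ * r ≤ r := by
    have : θ ≤ 1 := min_le_left _ _
    nlinarith
  have hr2 : θ * r ≤ rμ := by
    have : θ ≤ rμ / R := min_le_right _ _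
    calc θ * r ≤ rμ / R * R := by gcongr
      _ = rμ := by field_simp
  have hΩ : MeasurableSet Ω := by
    rw [← hQ.support_eq]; exact Measure.isClosed_support.measurableSet
  have hball : MeasurableSet (Metric.ball x (θ * r)) := measurableSet_ball
  have h1 := hQ.regular _ hr' hr2 x hx
  calc ENNReal.ofReal (μlo * cμ * v * θ ^ d * r ^ d)
      = ENNReal.ofReal μlo * (ENNReal.ofReal cμ * volume (Metric.ball x (θ * r))) := by
        rw [Measure.addHaar_ball_of_pos _ _ hr', finrank_euclideanSpace, Fintype.card_fin,
          ← ENNReal.ofReal_toReal hvt, ← hv, ← ENNReal.ofReal_mul (by positivity),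
          ← ENNReal.ofReal_mul (by positivity), ← ENNReal.ofReal_mul (by positivity)]
        congr 1; rw [mul_pow]; ring
    _ ≤ ENNReal.ofReal μlo * volume (Ω ∩ Metric.ball x (θ * r)) := by gcongr
    _ = ∫⁻ _ in Ω ∩ Metric.ball x (θ * r), ENNReal.ofReal μlo := by simp
    _ ≤ ∫⁻ y in Ω ∩ Metric.ball x (θ * r), Q.rnDeriv volume y := by
        refine lintegral_mono_ae ?_
        have := ae_restrict_of_ae_restrict_of_subset
          (inter_subset_left : Ω ∩ Metric.ball x (θ * r) ⊆ Ω) hQ.density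
        filter_upwards [this] with y hy using hy.1.le
    _ ≤ Q (Ω ∩ Metric.ball x (θ * r)) := Measure.setLIntegral_rnDeriv_le _
    _ ≤ Q (Metric.ball x r) := measure_mono (inter_subset_right.trans (Metric.ball_subset_ball hr1))

/-! ### Measurability of the classifier -/

theorem measurableSet_sort_eq {N : ℕ} (σ : Equiv.Perm (Fin N)) :
    MeasurableSet {f : Fin N → ℝ | Tuple.sort f = σ} := by
  -- The sorting permutation is characterised by finitely many comparisons: monotonicity, and index
  -- order among ties.
  have : {f : Fin N → ℝ | Tuple.sort f = σ} =
      (⋂ i, ⋂ j, ⋂ (_ : i ≤ j), {f | f (σ i) ≤ f (σ j)}) ∩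
        ⋂ i, ⋂ j, ⋂ (_ : i < j), {f | f (σ i) = f (σ j) → σ i < σ j} := by
    ext f
    rw [mem_ofPred_eq, eq_comm, Tuple.eq_sort_iff]
    simp [Monotone]
  rw [this]
  refine MeasurableSet.inter ?_ ?_
  · exact MeasurableSet.iInter fun i => MeasurableSet.iInter fun j => MeasurableSet.iInter fun _ =>
      measurableSet_le (measurable_pi_apply (σ i)) (measurable_pi_apply (σ j))
  · refine MeasurableSet.iInter fun i => MeasurableSet.iInter fun j => MeasurableSet.iInter fun _ => ?_
    by_cases h : σ i < σ j
    · simp [h]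
    · simp only [h, imp_false]
      exact (measurableSet_eq_fun (measurable_pi_apply (X := fun _ : Fin N => ℝ) (σ i))
        (measurable_pi_apply (X := fun _ : Fin N => ℝ) (σ j))).compl

theorem measurable_nnLabel {N : ℕ} (j : Fin N) :
    Measurable fun z : (Fin N → Obs d) × Feature d => nnLabel z.1 z.2 j := by
  refine measurable_to_bool ?_
  have hf : Measurable fun (z : (Fin N → Obs d) × Feature d) (l : Fin N) =>
      dist (z.1 l).1 z.2 := by fun_prop
  have : (fun z : (Fin N → Obs d) × Feature d => nnLabel z.1 z.2 j) ⁻¹' {true} =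
      ⋃ σ : Equiv.Perm (Fin N), {z | Tuple.sort (fun l => dist (z.1 l).1 z.2) = σ} ∩
        {z | (z.1 (σ j)).2 = true} := by
    ext z; simp [nnLabel]
  rw [this]
  refine MeasurableSet.iUnion fun σ => (hf (measurableSet_sort_eq σ)).inter ?_
  have : Measurable fun z : (Fin N → Obs d) × Feature d => (z.1 (σ j)).2 := by fun_prop
  exact this (measurableSet_singleton true)

theorem measurable_etaHat (β : ℝ) {m : ℕ} (γ : Fin (m + 1) → ℝ) (n : Fin (m + 1) → ℕ) :
    Measurable fun z : Sample d n × Feature d => etaHat β γ z.1 z.2 := by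
  unfold etaHat
  refine Measurable.div_const (Finset.measurable_sum _ fun i _ => Measurable.const_mul
    (Finset.measurable_sum _ fun j _ => ?_) _) _
  split_ifs
  · have h1 : Measurable labelVal := measurable_of_finite _
    have h2 : Measurable fun z : Sample d n × Feature d => (z.1 i, z.2) := by fun_prop
    exact h1.comp ((measurable_nnLabel j).comp h2)
  · exact measurable_const

theorem measurable_classifier (β : ℝ) {m : ℕ} (γ : Fin (m + 1) → ℝ) (n : Fin (m + 1) → ℕ) :
    Measurable fun z : Sample d n × Feature d => classifier β γ z.1 z.2 := by
  refine measurable_to_bool ?_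
  convert measurableSet_lt (measurable_const (a := (1 / 2 : ℝ))) (measurable_etaHat (d := d) β γ n)
    using 1
  ext z; simp [classifier]

/-! ### Votes as sums over sample indices -/

/-- The indicator that the `l`-th point is one of the `k` nearest neighbours of `x`. -/
noncomputable def nbrInd {N : ℕ} (X : Fin N → Feature d) (x : Feature d) (k : ℕ) (l : Fin N) : ℝ :=
  if ((Tuple.sort fun l => dist (X l) x).symm l : ℕ) < k then 1 else 0

theorem nbrInd_nonneg {N : ℕ} (X : Fin N → Feature d) (x : Feature d) (k : ℕ) (l : Fin N) :
    0 ≤ nbrInd X x k l := by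
  unfold nbrInd; split_ifs <;> simp

theorem nbrInd_sq {N : ℕ} (X : Fin N → Feature d) (x : Feature d) (k : ℕ) (l : Fin N) :
    nbrInd X x k l ^ 2 = nbrInd X x k l := by
  unfold nbrInd; split_ifs <;> simp

/-- Passing from ranks to sample indices gives coefficients that depend on the features only. Given
the features, the vote is thus a fixed linear combination of independent labels, as Hoeffding's
inequality requires. -/
theorem sum_nnLabel {N : ℕ} (s : Fin N → Obs d) (x : Feature d) (k : ℕ) :
    (∑ j : Fin N, if (j : ℕ) < k then labelVal (nnLabel s x j) else 0) =
      ∑ l, nbrInd (fun l => (s l).1) x k l * labelVal (s l).2 := by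
  rw [← Equiv.sum_comp (Tuple.sort fun l => dist (s l).1 x)
    fun l => nbrInd (fun l => (s l).1) x k l * labelVal (s l).2]
  refine Finset.sum_congr rfl fun j _ => ?_
  simp [nbrInd, nnLabel]

theorem sum_nbrInd {N : ℕ} (X : Fin N → Feature d) (x : Feature d) {k : ℕ} (hk : k ≤ N) :
    ∑ l, nbrInd X x k l = k := by
  rw [← Equiv.sum_comp (Tuple.sort fun l => dist (X l) x)]
  simp [nbrInd, Fin.card_filter_val_lt, hk]

-- Sorted distances are monotone, so the points in the ball occupy an initial segment of ranks; a
-- rank below `k` lies in this segment.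
open Classical in
theorem nbrInd_eq_zero {N : ℕ} (X : Fin N → Feature d) (x : Feature d) {k : ℕ} {r : ℝ}
    (hk : k ≤ (Finset.univ.filter fun l => X l ∈ Metric.ball x r).card) {l : Fin N}
    (hl : X l ∉ Metric.ball x r) : nbrInd X x k l = 0 := by
  set f : Fin N → ℝ := fun l => dist (X l) x
  set σ := Tuple.sort f
  refine if_neg fun hlt => hl ?_
  change ((σ.symm l : Fin N) : ℕ) < k at hlt
  have hcard : (Finset.univ.filter fun l => X l ∈ Metric.ball x r).card =
      (Finset.univ.filter fun j => (f ∘ σ) j < r).card := by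
    refine (Finset.card_equiv σ fun j => ?_).symm
    simp [f, Metric.mem_ball]
  have := (Tuple.lt_card_lt_iff_apply_lt_of_monotone (j := σ.symm l) (a := r)
    (Tuple.monotone_sort f)).1 (by rw [← hcard]; omega)
  simpa [f, σ] using this

/-! ### Probability of a wrong vote -/

/-- All observations, drawn from the features `z.1` and the uniform variables `z.2`. -/
noncomputable def drawSample {m : ℕ} {n : Fin (m + 1) → ℕ} (η : Fin (m + 1) → Feature d → ℝ)
    (z : ((i : Fin (m + 1)) → Fin (n i) → Feature d) × ((i : Fin (m + 1)) → Fin (n i) → ℝ)) :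
    Sample d n :=
  fun i l => drawObs (η i) (z.1 i l, z.2 i l)

theorem measurable_drawSample {m : ℕ} {n : Fin (m + 1) → ℕ} {η : Fin (m + 1) → Feature d → ℝ}
    (hη : ∀ i, Measurable (η i)) : Measurable (drawSample (n := n) η) :=
  measurable_pi_lambda _ fun i => measurable_pi_lambda _ fun l =>
    (measurable_drawObs (hη i)).comp (by fun_prop)

theorem sampleLaw_eq_map {m : ℕ} (n : Fin (m + 1) → ℕ) {P : Fin (m + 1) → ProbabilityMeasure (Obs d)}
    {η : Fin (m + 1) → Feature d → ℝ} (hη : ∀ i, IsRegressionFunction (P i) (η i)) :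
    sampleLaw P n =
      ((Measure.pi fun i => Measure.pi fun _ : Fin (n i) => marginal (P i)).prod
        (Measure.pi fun i => Measure.pi fun _ : Fin (n i) => unif)).map (drawSample η) := by
  have h1 : ∀ i, Measure.pi (fun _ : Fin (n i) => (P i : Measure (Obs d))) =
      ((Measure.pi fun _ : Fin (n i) => marginal (P i)).prod
        (Measure.pi fun _ : Fin (n i) => unif)).map
          (fun z l => drawObs (η i) (z.1 l, z.2 l)) := by
    intro i
    rw [← pi_eq_map_prod_pi (fun _ : Fin (n i) => marginal (P i)) (fun _ => unif)
      (fun _ => drawObs (η i)) (fun _ => measurable_drawObs (hη i).measurable)]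
    rw [← (hη i).eq_map_drawObs]
  rw [sampleLaw]
  simp_rw [h1]
  refine pi_eq_map_prod_pi (fun i => Measure.pi fun _ : Fin (n i) => marginal (P i))
    (fun i => Measure.pi fun _ : Fin (n i) => unif)
    (fun i z l => drawObs (η i) (z.1 l, z.2 l)) fun i => ?_
  exact measurable_pi_lambda _ fun l => (measurable_drawObs (hη i).measurable).comp (by fun_prop)

open Classical in
/-- The features fail to lie in `Ω`, or too few of them lie in a set `B`, with small probability. -/
theorem measure_few_neighbors {m : ℕ} (n : Fin (m + 1) → ℕ) (Q : Fin (m + 1) → Measure (Feature d))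
    [∀ i, IsProbabilityMeasure (Q i)] {Ω B : Set (Feature d)} (hΩ : ∀ i, Q i Ωᶜ = 0)
    (hB : MeasurableSet B) {q : ℝ} (hq : ∀ i, ENNReal.ofReal q ≤ Q i B)
    (k : Fin (m + 1) → ℕ) (big : Finset (Fin (m + 1))) :
    Measure.pi (fun i => Measure.pi fun _ : Fin (n i) => Q i)
      {X | ¬ ((∀ i l, X i l ∈ Ω) ∧ ∀ i ∈ big, k i ≤ (Finset.univ.filter fun l => X i l ∈ B).card)} ≤
    ∑ i ∈ big, ENNReal.ofReal (Real.exp (k i - n i * q / 2)) := by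
  set μ := Measure.pi (fun i => Measure.pi fun _ : Fin (n i) => Q i)
  have hsub : {X : (i : Fin (m + 1)) → Fin (n i) → Feature d | ¬ ((∀ i l, X i l ∈ Ω) ∧
      ∀ i ∈ big, k i ≤ (Finset.univ.filter fun l => X i l ∈ B).card)} ⊆
      (⋃ i, ⋃ l, {X | X i l ∈ Ωᶜ}) ∪
      ⋃ i ∈ big, {X | ((Finset.univ.filter fun l => X i l ∈ B).card : ℝ) < k i} := by
    intro X hX
    simp only [mem_ofPred_eq, not_and_or, not_forall, not_le] at hX
    rcases hX with ⟨i, l, h⟩ | ⟨i, hi, h⟩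
    · exact Or.inl (mem_iUnion.2 ⟨i, mem_iUnion.2 ⟨l, h⟩⟩)
    · exact Or.inr (mem_iUnion₂.2 ⟨i, hi, by simpa using h⟩)
  have hnull : μ (⋃ i, ⋃ l, {X | X i l ∈ Ωᶜ}) = 0 := by
    refine measure_iUnion_null fun i => measure_iUnion_null fun l => ?_
    have hev : MeasurePreserving (fun X : (i : Fin (m + 1)) → Fin (n i) → Feature d => X i l) μ
        (Q i) :=
      (measurePreserving_eval (fun _ : Fin (n i) => Q i) l).comp
        (measurePreserving_eval (fun i => Measure.pi fun _ : Fin (n i) => Q i) i)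
    exact hev.quasiMeasurePreserving.preimage_null (hΩ i)
  refine (measure_mono hsub).trans ((measure_union_le _ _).trans ?_)
  rw [hnull, zero_add]
  refine (measure_biUnion_finset_le _ _).trans (Finset.sum_le_sum fun i _ => ?_)
  refine le_trans ?_ (chernoff_lower (Q i) hB (hq i) (n i) (k i))
  refine (measurePreserving_eval (fun i => Measure.pi fun _ : Fin (n i) => Q i) i).measure_preimage_le
    {s | ((Finset.univ.filter fun l => s l ∈ B).card : ℝ) < k i}

/-- The probability of a wrong weighted vote at `x`, in terms of the signal strengths `g i` of the
data sets near `x`; only the data sets in `big` are required to have close neighbours. -/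
theorem measure_wrong_vote {m : ℕ} (n : Fin (m + 1) → ℕ) {P : Fin (m + 1) → ProbabilityMeasure (Obs d)}
    {η : Fin (m + 1) → Feature d → ℝ} (hη : ∀ i, IsRegressionFunction (P i) (η i))
    {Ω : Set (Feature d)} (hΩ : ∀ i, marginal (P i) Ωᶜ = 0) {x : Feature d} {r q : ℝ}
    (hq : ∀ i, ENNReal.ofReal q ≤ marginal (P i) (Metric.ball x r))
    {k : Fin (m + 1) → ℕ} (hk : ∀ i, k i ≤ n i) {w g : Fin (m + 1) → ℝ} (hw : ∀ i, 0 ≤ w i)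
    {sg : ℝ} (hsg : sg = 1 ∨ sg = -1) (big : Finset (Fin (m + 1)))
    (hg : ∀ i, ∀ y ∈ Ω ∩ Metric.ball x r, g i ≤ sg * (η i y - 1 / 2))
    {D : ℝ} (hD : 0 ≤ D)
    (hDle : D ≤ ∑ i ∈ big, w i * k i * g i - 1 / 2 * ∑ i ∈ bigᶜ, w i * k i)
    {E : Set (Sample d n)} (hE : MeasurableSet E)
    (hEsub : ∀ s ∈ E, sg * (∑ i, w i * ∑ l, nbrInd (fun l => (s i l).1) x (k i) l *
      labelVal (s i l).2 - 1 / 2 * ∑ i, w i * k i) ≤ 0) :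
    sampleLaw P n E ≤ ENNReal.ofReal (Real.exp (-(2 * D ^ 2 / ∑ i, w i ^ 2 * k i))) +
      ∑ i ∈ big, ENNReal.ofReal (Real.exp (k i - n i * q / 2)) := by
  classical
  have hm := measurable_drawSample (n := n) fun i => (hη i).measurable
  rw [sampleLaw_eq_map n hη, Measure.map_apply hm hE, Measure.prod_apply (hm hE)]
  set μ := Measure.pi fun i => Measure.pi fun _ : Fin (n i) => marginal (P i)
  set ν := Measure.pi fun i => Measure.pi fun _ : Fin (n i) => unif
  set bad := {X : (i : Fin (m + 1)) → Fin (n i) → Feature d | ¬ ((∀ i l, X i l ∈ Ω) ∧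
      ∀ i ∈ big, k i ≤ (Finset.univ.filter fun l => X i l ∈ Metric.ball x r).card)} with hbad
  have hbadle : μ bad ≤ ∑ i ∈ big, ENNReal.ofReal (Real.exp (k i - n i * q / 2)) :=
    measure_few_neighbors n (fun i => marginal (P i)) hΩ measurableSet_ball hq k big
  set a := ENNReal.ofReal (Real.exp (-(2 * D ^ 2 / ∑ i, w i ^ 2 * k i))) with ha
  have hsg2 : sg ^ 2 = 1 := by rcases hsg with rfl | rfl <;> norm_num
  -- Fubini with the features fixed: bad features get the trivial bound `1`, good ones Hoeffding's.
  -- Measurability of `bad` is not assumed, hence the measurable hull.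
  have hpt : ∀ X, ν (Prod.mk X ⁻¹' (drawSample η ⁻¹' E)) ≤
      a + (toMeasurable μ bad).indicator 1 X := by
    intro X
    by_cases hX : X ∈ bad
    · rw [indicator_of_mem (subset_toMeasurable _ _ hX)]
      exact le_add_left prob_le_one
    · refine le_add_right ?_
      simp only [hbad, mem_ofPred_eq, not_not] at hX
      obtain ⟨hXΩ, hXk⟩ := hX
      -- The coefficients are constants once `X` is fixed; since `nbrInd` squares to itself, the sum
      -- of their squares is `∑ w_i² k_i`.
      have hhoef := hoeffding_bernoulli (fun i l => η i (X i l))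
        (fun i l => sg * w i * nbrInd (X i) x (k i) l) (fun i l => (hη i).mem_Icc _) hD
      have hvar : ∑ i, ∑ l, (sg * w i * nbrInd (X i) x (k i) l) ^ 2 = ∑ i, w i ^ 2 * k i := by
        refine Finset.sum_congr rfl fun i _ => ?_
        simp_rw [mul_pow, nbrInd_sq, hsg2, one_mul]
        rw [← Finset.mul_sum, sum_nbrInd _ _ (hk i)]
      rw [hvar] at hhoef
      refine le_trans (measure_mono ?_) hhoef
      intro u hu
      have hu' := hEsub _ hu
      have hsplit : ∀ i, ∑ l, sg * w i * nbrInd (X i) x (k i) l *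
          ((if u i l < η i (X i l) then 1 else 0) - η i (X i l)) =
          sg * (w i * ∑ l, nbrInd (X i) x (k i) l * (if u i l < η i (X i l) then 1 else 0)) -
            sg * (1 / 2 * (w i * k i)) -
            w i * ∑ l, nbrInd (X i) x (k i) l * (sg * (η i (X i l) - 1 / 2)) := by
        intro i
        rw [← sum_nbrInd (X i) x (hk i)]
        simp only [Finset.mul_sum, ← Finset.sum_sub_distrib]
        refine Finset.sum_congr rfl fun l _ => ?_
        ring
      have hlow : ∀ i ∈ big, w i * k i * g i ≤
          w i * ∑ l, nbrInd (X i) x (k i) l * (sg * (η i (X i l) - 1 / 2)) := by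
        intro i hi
        rw [mul_assoc]
        refine mul_le_mul_of_nonneg_left ?_ (hw i)
        rw [← sum_nbrInd (X i) x (hk i), Finset.sum_mul]
        refine Finset.sum_le_sum fun l _ => ?_
        by_cases hl : X i l ∈ Metric.ball x r
        · exact mul_le_mul_of_nonneg_left (hg i _ ⟨hXΩ i l, hl⟩) (nbrInd_nonneg _ _ _ _)
        · rw [nbrInd_eq_zero (X i) x (hXk i hi) hl]; simp
      -- Here the neighbours may be far away; only `η ∈ [0, 1]` is used, so each contributes at
      -- least `-1/2`.
      have hlow' : ∀ i ∈ bigᶜ, -(1 / 2 * (w i * k i)) ≤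
          w i * ∑ l, nbrInd (X i) x (k i) l * (sg * (η i (X i l) - 1 / 2)) := by
        intro i _
        have : -(1 / 2 * (w i * k i)) = w i * ∑ l, nbrInd (X i) x (k i) l * (-1 / 2) := by
          rw [← Finset.sum_mul, sum_nbrInd (X i) x (hk i)]; ring
        rw [this]
        refine mul_le_mul_of_nonneg_left (Finset.sum_le_sum fun l _ =>
          mul_le_mul_of_nonneg_left ?_ (nbrInd_nonneg _ _ _ _)) (hw i)
        have h0 := ((hη i).mem_Icc (X i l)).1
        have h1 := ((hη i).mem_Icc (X i l)).2
        rcases hsg with rfl | rfl <;> linarith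
      have htot : ∑ i ∈ big, w i * k i * g i - 1 / 2 * ∑ i ∈ bigᶜ, w i * k i ≤
          ∑ i, w i * ∑ l, nbrInd (X i) x (k i) l * (sg * (η i (X i l) - 1 / 2)) := by
        rw [← Finset.sum_add_sum_compl big fun i =>
          w i * ∑ l, nbrInd (X i) x (k i) l * (sg * (η i (X i l) - 1 / 2))]
        have h1 := Finset.sum_le_sum hlow
        have h2 := Finset.sum_le_sum hlow'
        rw [Finset.sum_neg_distrib, ← Finset.mul_sum] at h2
        linarith
      simp only [mem_ofPred_eq, hsplit, Finset.sum_sub_distrib, ← Finset.mul_sum]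
      simp only [drawSample, drawObs, labelVal, decide_eq_true_eq] at hu'
      replace htot := hDle.trans htot
      simp only [Finset.mul_sum, mul_sub] at hu' htot ⊢
      linarith
  calc ∫⁻ X, ν (Prod.mk X ⁻¹' (drawSample η ⁻¹' E)) ∂μ
      ≤ ∫⁻ X, (a + (toMeasurable μ bad).indicator 1 X) ∂μ := lintegral_mono hpt
    _ = a + μ bad := by
      rw [lintegral_add_left measurable_const, lintegral_indicator_one (measurableSet_toMeasurable _ _),
        measure_toMeasurable]
      simp
    _ ≤ _ := by gcongr

/-! ### Weights and neighbour numbers in terms of the accuracy -/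

/-- The accuracy `M ^ (-β / (2β + d))`, with `M = maxEff d β γ n`, at which `η 0` is estimated. -/
noncomputable def rate (d : ℕ) (β : ℝ) {m : ℕ} (γ : Fin (m + 1) → ℝ) (n : Fin (m + 1) → ℕ) : ℝ :=
  maxEff d β γ n ^ (-(β / (2 * β + d)))

section Rate

variable {d : ℕ} {β : ℝ} {m : ℕ} {γ : Fin (m + 1) → ℝ} {n : Fin (m + 1) → ℕ}

theorem le_maxEff (i : Fin (m + 1)) :
    (n i : ℝ) ^ ((2 * β + d) / (2 * γ i * β + d)) ≤ maxEff d β γ n :=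
  Finset.le_sup' (fun i => (n i : ℝ) ^ ((2 * β + d) / (2 * γ i * β + d))) (Finset.mem_univ i)

theorem one_le_maxEff (hβ : 0 < β) (hγ : ∀ i, 0 < γ i) (hn : ∀ i, 1 ≤ n i) :
    1 ≤ maxEff d β γ n := by
  refine le_trans (Real.one_le_rpow (by exact_mod_cast hn 0) ?_) (le_maxEff 0)
  have := hγ 0
  positivity

theorem rate_pos (hβ : 0 < β) (hγ : ∀ i, 0 < γ i) (hn : ∀ i, 1 ≤ n i) : 0 < rate d β γ n :=
  Real.rpow_pos_of_pos (one_pos.trans_le (one_le_maxEff hβ hγ hn)) _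

theorem rate_le_one (hβ : 0 < β) (hγ : ∀ i, 0 < γ i) (hn : ∀ i, 1 ≤ n i) : rate d β γ n ≤ 1 := by
  refine Real.rpow_le_one_of_one_le_of_nonpos (one_le_maxEff hβ hγ hn) ?_
  rw [neg_nonpos]; positivity

theorem rate_rpow (hβ : 0 < β) (hγ : ∀ i, 0 < γ i) (hn : ∀ i, 1 ≤ n i) (y : ℝ) :
    rate d β γ n ^ y = maxEff d β γ n ^ (-(β * y / (2 * β + d))) := by
  rw [rate, ← Real.rpow_mul (zero_le_one.trans (one_le_maxEff hβ hγ hn))]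
  congr 1; ring

theorem weight_eq (hβ : 0 < β) (hγ : ∀ i, 0 < γ i) (hn : ∀ i, 1 ≤ n i) (i : Fin (m + 1)) :
    weight d β γ n i = rate d β γ n ^ γ i := by
  rw [rate_rpow hβ hγ hn, weight, mul_comm β]

theorem numNeighbors_le_mul (hβ : 0 < β) (hγ : ∀ i, 0 < γ i) (hn : ∀ i, 1 ≤ n i) (i : Fin (m + 1)) :
    (numNeighbors d β γ n i : ℝ) ≤ n i * rate d β γ n ^ (d / β) := by
  have hM := one_pos.trans_le (one_le_maxEff (d := d) hβ hγ hn)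
  rw [rate_rpow hβ hγ hn, mul_div_cancel₀ _ hβ.ne']
  exact Nat.floor_le (by positivity)

theorem numNeighbors_le (hβ : 0 < β) (hγ : ∀ i, 0 < γ i) (hn : ∀ i, 1 ≤ n i) (i : Fin (m + 1)) :
    numNeighbors d β γ n i ≤ n i := by
  have h := numNeighbors_le_mul (d := d) hβ hγ hn i
  have h1 : rate d β γ n ^ (d / β) ≤ 1 :=
    Real.rpow_le_one (rate_pos hβ hγ hn).le (rate_le_one hβ hγ hn) (by positivity)
  have : (numNeighbors d β γ n i : ℝ) ≤ n i :=
    h.trans (mul_le_of_le_one_right (Nat.cast_nonneg _) h1)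
  exact_mod_cast this

/-- A single term suffices: for the index attaining `maxEff`, the number under the floor is exactly
`w_i⁻² ≥ 1`, and the floor of a number at least `1` is at least half of it. -/
theorem half_le_sum_weight (hβ : 0 < β) (hγ : ∀ i, 0 < γ i) (hn : ∀ i, 1 ≤ n i) :
    1 / 2 ≤ ∑ i, weight d β γ n i ^ 2 * numNeighbors d β γ n i := by
  have hM1 := one_le_maxEff (d := d) hβ hγ hn
  have hM := one_pos.trans_le hM1
  obtain ⟨i, -, hi⟩ := Finset.exists_mem_eq_sup' (Finset.univ_nonempty (α := Fin (m + 1)))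
    fun i => (n i : ℝ) ^ ((2 * β + d) / (2 * γ i * β + d))
  change maxEff d β γ n = _ at hi
  have hγi := hγ i
  set M := maxEff d β γ n with hMdef
  have hni : (n i : ℝ) = M ^ ((2 * γ i * β + d) / (2 * β + d)) := by
    rw [hi, ← Real.rpow_mul (Nat.cast_nonneg _), div_mul_div_cancel₀ (by positivity),
      div_self (by positivity), Real.rpow_one]
  have hprod : (n i : ℝ) * M ^ (-((d : ℝ) / (2 * β + d))) = M ^ (2 * (γ i * β / (2 * β + d))) := by
    rw [hni, ← Real.rpow_add hM]
    congr 1; field_simp; ring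
  have hge : (1 : ℝ) ≤ M ^ (2 * (γ i * β / (2 * β + d))) := Real.one_le_rpow hM1 (by positivity)
  have hk : M ^ (2 * (γ i * β / (2 * β + d))) / 2 ≤ (numNeighbors d β γ n i : ℝ) := by
    rw [numNeighbors, ← hMdef, hprod]
    have h1 := Nat.lt_floor_add_one (M ^ (2 * (γ i * β / (2 * β + d))))
    have h2 : (1 : ℝ) ≤ (⌊M ^ (2 * (γ i * β / (2 * β + d)))⌋₊ : ℝ) := by
      exact_mod_cast Nat.one_le_floor_iff _ |>.2 hge
    linarith
  refine le_trans ?_ (Finset.single_le_sum (f := fun i =>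
    weight d β γ n i ^ 2 * (numNeighbors d β γ n i : ℝ)) (fun j _ => by positivity)
    (Finset.mem_univ i))
  calc (1 : ℝ) / 2 = weight d β γ n i ^ 2 * (M ^ (2 * (γ i * β / (2 * β + d))) / 2) := by
        rw [weight, ← hMdef, ← Real.rpow_natCast, ← Real.rpow_mul hM.le, ← mul_div_assoc,
          ← Real.rpow_add hM]
        rw [show -(γ i * β / (2 * β + d)) * ((2 : ℕ) : ℝ) + 2 * (γ i * β / (2 * β + d)) = 0 by
          push_cast; ring, Real.rpow_zero]
    _ ≤ _ := by gcongr

/-- Since `γ 0 = 1`, the expert sample size `n 0` itself is one of the terms of the maximum. -/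
theorem rate_le_of_le (hβ : 0 < β) (hγ0 : γ 0 = 1) (hn : ∀ i, 1 ≤ n i) :
    rate d β γ n ≤ (n 0 : ℝ) ^ (-(β / (2 * β + d))) := by
  have h := le_maxEff (d := d) (β := β) (γ := γ) (n := n) 0
  have hn0 : (0 : ℝ) < n 0 := by exact_mod_cast hn 0
  rw [hγ0, mul_one, div_self (by positivity), Real.rpow_one] at h
  refine Real.rpow_le_rpow_of_nonpos hn0 h ?_
  rw [neg_nonpos]; positivity

end Rate

/-! ### Pointwise error bound -/

/-- A wrong label at `x` means that the weighted votes have the wrong sign. -/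
theorem vote_of_disagree {β : ℝ} {m : ℕ} {γ : Fin (m + 1) → ℝ} {n : Fin (m + 1) → ℕ}
    (hpos : 0 < ∑ i, weight d β γ n i * (numNeighbors d β γ n i : ℝ)) {s : Sample d n}
    {x : Feature d} {p sg : ℝ} (hsg : (sg = 1 ∧ 1 / 2 < p) ∨ (sg = -1 ∧ p < 1 / 2))
    (h : Disagree (classifier β γ s x) p) :
    sg * (∑ i, weight d β γ n i * ∑ l, nbrInd (fun l => (s i l).1) x (numNeighbors d β γ n i) l *
      labelVal (s i l).2 - 1 / 2 * ∑ i, weight d β γ n i * numNeighbors d β γ n i) ≤ 0 := by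
  have hη : etaHat β γ s x = (∑ i, weight d β γ n i * ∑ l, nbrInd (fun l => (s i l).1) x
      (numNeighbors d β γ n i) l * labelVal (s i l).2) /
      ∑ i, weight d β γ n i * (numNeighbors d β γ n i : ℝ) := by
    rw [etaHat]; simp_rw [sum_nnLabel]
  rcases h with ⟨h1, h2⟩ | ⟨h1, h2⟩
  · rcases hsg with ⟨-, h3⟩ | ⟨rfl, -⟩
    · linarith
    · simp only [classifier, decide_eq_true_eq] at h1
      rw [hη, lt_div_iff₀ hpos] at h1
      linarith
  · rcases hsg with ⟨rfl, -⟩ | ⟨-, h3⟩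
    · simp only [classifier, decide_eq_false_iff_not, not_lt] at h1
      rw [hη, div_le_iff₀ hpos] at h1
      linarith
    · linarith

/-- The data sets with at most `L` neighbours do not spoil the total signal. -/
theorem signal_lower {m : ℕ} {γ : Fin (m + 1) → ℝ} {k : Fin (m + 1) → ℕ} {δ c v : ℝ} {L : ℕ}
    (hδ0 : 0 < δ) (hδ1 : δ ≤ 1) (hc : 0 < c) (hc1 : c ≤ 1) (hγc : ∀ i, c ≤ γ i) (hv1 : 1 ≤ v)
    (hδv : δ * v ≤ 1) (hS : 1 / 2 ≤ ∑ i, (δ ^ γ i) ^ 2 * (k i : ℝ))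
    (hL : (m + 1) * L * δ ^ c ≤ c / 6) :
    c / 2 * (∑ i, (δ ^ γ i) ^ 2 * (k i : ℝ)) * v ^ c ≤
      ∑ i ∈ Finset.univ.filter (fun i => L < k i), δ ^ γ i * k i * (c * (δ * v) ^ γ i) -
        1 / 2 * ∑ i ∈ (Finset.univ.filter fun i => L < k i)ᶜ, δ ^ γ i * (k i : ℝ) := by
  set big := Finset.univ.filter fun i => L < k i with hbig
  have hvc : 1 ≤ v ^ c := Real.one_le_rpow hv1 hc.le
  set S := ∑ i, (δ ^ γ i) ^ 2 * (k i : ℝ) with hSdef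
  -- The factor `δ ^ γ i` of the signal matches the weight, producing the square; `v ^ γ i ≥ v ^ c`
  -- as `v ≥ 1`.
  have hall : c * S * v ^ c ≤ ∑ i, δ ^ γ i * k i * (c * (δ * v) ^ γ i) := by
    rw [hSdef, mul_right_comm, Finset.mul_sum]
    refine Finset.sum_le_sum fun i _ => ?_
    rw [Real.mul_rpow hδ0.le (by positivity)]
    have h1 : v ^ c ≤ v ^ γ i := Real.rpow_le_rpow_of_exponent_le hv1 (hγc i)
    calc c * v ^ c * ((δ ^ γ i) ^ 2 * k i) ≤ c * v ^ γ i * ((δ ^ γ i) ^ 2 * k i) := by gcongr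
      _ = _ := by ring
  rw [← Finset.sum_add_sum_compl big] at hall
  have hsmall1 : ∑ i ∈ bigᶜ, δ ^ γ i * k i * (c * (δ * v) ^ γ i) ≤
      ∑ i ∈ bigᶜ, δ ^ γ i * (k i : ℝ) := by
    refine Finset.sum_le_sum fun i _ => mul_le_of_le_one_right (by positivity) ?_
    have h3 : (δ * v) ^ γ i ≤ 1 := Real.rpow_le_one (by positivity) hδv (hc.le.trans (hγc i))
    exact mul_le_one₀ hc1 (by positivity) h3
  have hsmall2 : ∑ i ∈ bigᶜ, δ ^ γ i * (k i : ℝ) ≤ c / 6 := by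
    refine le_trans ?_ hL
    calc ∑ i ∈ bigᶜ, δ ^ γ i * (k i : ℝ) ≤ ∑ i ∈ bigᶜ, δ ^ c * (L : ℝ) := by
          refine Finset.sum_le_sum fun i hi => ?_
          have hi' : k i ≤ L := by simpa [hbig] using hi
          have : (k i : ℝ) ≤ L := by exact_mod_cast hi'
          exact mul_le_mul (Real.rpow_le_rpow_of_exponent_ge hδ0 hδ1 (hγc i)) this
            (Nat.cast_nonneg _) (by positivity)
      _ ≤ ∑ i : Fin (m + 1), δ ^ c * (L : ℝ) :=
          Finset.sum_le_sum_of_subset_of_nonneg (Finset.subset_univ _) fun _ _ _ => by positivity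
      _ = (m + 1) * L * δ ^ c := by
          rw [Finset.sum_const, Finset.card_univ, Fintype.card_fin]; simp; ring
  -- The small data sets cost at most `(1 + 1/2) · c/6 = c/4`: their lost signal and their adverse
  -- votes. This is at most half of `c S v ^ c`.
  have hSv : c * (1 / 2 * 1) ≤ c * (S * v ^ c) := by gcongr
  generalize v ^ c = V at *
  linarith

theorem measurable_classifier_left (β : ℝ) {m : ℕ} (γ : Fin (m + 1) → ℝ) (n : Fin (m + 1) → ℕ)
    (x : Feature d) : Measurable fun s : Sample d n => classifier β γ s x :=
  (measurable_classifier β γ n).of_uncurry_right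

theorem measurableSet_wrong (β : ℝ) {m : ℕ} (γ : Fin (m + 1) → ℝ) (n : Fin (m + 1) → ℕ)
    (x : Feature d) (p : ℝ) : MeasurableSet {s : Sample d n | Disagree (classifier β γ s x) p} := by
  have h := measurable_classifier_left β γ n x
  exact measurableSet_disagree h measurable_const

/-- Close to a point where the ground truth has signal `t`, every data set has a signal of the same
sign, of size at least `c (t / 2) ^ γ i`. -/
theorem signal_near {m : ℕ} {β Cβ c t r sg : ℝ} {γ Cγ : Fin (m + 1) → ℝ}
    {η : Fin (m + 1) → Feature d → ℝ} {Ω : Set (Feature d)} (hβ : 0 < β) (hCβ : 0 < Cβ)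
    (hc : 0 < c) (hc1 : c ≤ 1) (hγ0 : γ 0 = 1) (hγc : ∀ i, c ≤ γ i) (hCγc : ∀ i, c ≤ Cγ i)
    (hsmooth : ∀ x ∈ Ω, ∀ x' ∈ Ω, |η 0 x - η 0 x'| ≤ Cβ * ‖x - x'‖ ^ β)
    (hsig : ∀ i, i ≠ 0 → ∀ x ∈ Ω, 0 ≤ (η i x - 1 / 2) * (η 0 x - 1 / 2) ∧
      Cγ i * |η 0 x - 1 / 2| ^ γ i ≤ |η i x - 1 / 2|)
    {x : Feature d} (hx : x ∈ Ω) (ht0 : 0 < t) (hrβ : r ^ β = t / (2 * Cβ))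
    (hsg : sg = 1 ∨ sg = -1) (hsgt : sg * (η 0 x - 1 / 2) = t)
    (i : Fin (m + 1)) (y : Feature d) (hy : y ∈ Ω ∩ Metric.ball x r) :
    c * (t / 2) ^ γ i ≤ sg * (η i y - 1 / 2) := by
  -- The radius is such that `η 0` moves by at most `t / 2` on the ball. The other `η i` need no
  -- smoothness: their signal at `y` is compared with that of `η 0` at `y`.
  have hy0 : t / 2 ≤ sg * (η 0 y - 1 / 2) := by
    have h1 := hsmooth x hx y hy.1
    have h2 : Cβ * ‖x - y‖ ^ β ≤ t / 2 := by
      have : ‖x - y‖ ^ β ≤ t / (2 * Cβ) := by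
        rw [← hrβ]
        refine Real.rpow_le_rpow (norm_nonneg _) ?_ hβ.le
        rw [← dist_eq_norm, dist_comm]
        exact (Metric.mem_ball.1 hy.2).le
      calc Cβ * ‖x - y‖ ^ β ≤ Cβ * (t / (2 * Cβ)) := by gcongr
        _ = t / 2 := by field_simp
    have h3 := abs_le.1 (h1.trans h2)
    rcases hsg with h | h <;> rw [h] at hsgt ⊢ <;> linarith [h3.1, h3.2]
  by_cases hi : i = 0
  · subst hi
    rw [hγ0, Real.rpow_one]
    exact (mul_le_of_le_one_left (by positivity) hc1).trans hy0
  · obtain ⟨h1, h2⟩ := hsig i hi y hy.1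
    have habs : t / 2 ≤ |η 0 y - 1 / 2| := by
      refine hy0.trans ((le_abs_self _).trans ?_)
      rw [abs_mul]
      rcases hsg with h | h <;> simp [h]
    have h3 : c * (t / 2) ^ γ i ≤ |η i y - 1 / 2| := by
      refine le_trans ?_ h2
      have := hc.le.trans (hγc i)
      have : 0 ≤ Cγ i := hc.le.trans (hCγc i)
      have := hCγc i
      gcongr
    refine h3.trans (le_of_eq ?_)
    rcases hsg with h | h <;> rw [h] at hy0 ⊢
    · rw [abs_of_nonneg (nonneg_of_mul_nonneg_left h1 (by linarith)), one_mul]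
    · rw [abs_of_nonpos (nonpos_of_mul_nonneg_left h1 (by linarith)), neg_one_mul]

/-- The first exponential is the Hoeffding error, the second the union bound for neighbours too far
away. The constant `a` comes before `m`, the exponents, the sample sizes and `L`, which makes
uniformity in `m` possible. -/
theorem exists_pointwise_bound {β Cβ μlo μhi cμ rμ : ℝ} (hβ : 0 < β) (hCβ : 0 < Cβ) (hμlo : 0 < μlo)
    (hcμ : 0 < cμ) (hrμ : 0 < rμ) :
    ∃ a : ℝ, 0 < a ∧ ∀ {m : ℕ} {γ Cγ : Fin (m + 1) → ℝ} {c : ℝ}, 0 < c → c ≤ 1 → γ 0 = 1 →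
      (∀ i, c ≤ γ i) → (∀ i, c ≤ Cγ i) → ∀ {n : Fin (m + 1) → ℕ}, (∀ i, 1 ≤ n i) → ∀ {L : ℕ},
      (m + 1) * L * rate d β γ n ^ c ≤ c / 6 →
      ∀ {P : Fin (m + 1) → ProbabilityMeasure (Obs d)} {η : Fin (m + 1) → Feature d → ℝ}
        {Ω : Set (Feature d)}, (∀ i, IsRegressionFunction (P i) (η i)) →
        (∀ i, StrongDensity μlo μhi cμ rμ Ω (marginal (P i))) →
        (∀ x ∈ Ω, ∀ x' ∈ Ω, |η 0 x - η 0 x'| ≤ Cβ * ‖x - x'‖ ^ β) →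
        (∀ i, i ≠ 0 → ∀ x ∈ Ω, 0 ≤ (η i x - 1 / 2) * (η 0 x - 1 / 2) ∧
          Cγ i * |η 0 x - 1 / 2| ^ γ i ≤ |η i x - 1 / 2|) →
        ∀ x ∈ Ω, ∀ {v : ℝ}, |η 0 x - 1 / 2| = 2 * rate d β γ n * v → 1 ≤ v →
          1 ≤ a * v ^ (d / β) →
          sampleLaw P n {s | Disagree (classifier β γ s x) (η 0 x)} ≤
            ENNReal.ofReal (Real.exp (-(c ^ 2 / 4 * v ^ (2 * c))) +
              (m + 1) * Real.exp (-((L + 1) * (a * v ^ (d / β))))) := by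
  -- The largest radius that occurs, because `|η 0 x - 1/2| ≤ 1/2`.
  set R : ℝ := (1 / (4 * Cβ)) ^ (1 / β) with hR
  obtain ⟨c₀, hc₀, hmass⟩ := exists_ball_mass_lower (d := d) (μhi := μhi) hμlo hcμ hrμ
    (R := R) (by positivity)
  -- With this `a` and `A = a v ^ (d / β)`, the lower bound `q` for the mass of the ball is `4 A δ ^
  -- (d / β)`, so at least `4 A k_i` points are expected in it.
  refine ⟨c₀ * (1 / Cβ) ^ (d / β) / 4, by positivity, ?_⟩
  intro m γ Cγ c hc hc1 hγ0 hγc hCγc n hn L hL P η Ω hη hdens hsmooth hsig x hx v hv hv1 hav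
  have hγ : ∀ i, 0 < γ i := fun i => hc.trans_le (hγc i)
  set δ := rate d β γ n with hδ
  have hδ0 : 0 < δ := rate_pos hβ hγ hn
  have hδ1 : δ ≤ 1 := rate_le_one hβ hγ hn
  set t := |η 0 x - 1 / 2| with ht
  have ht0 : 0 < t := by rw [hv]; positivity
  have ht1 : t ≤ 1 / 2 := by
    rw [ht, abs_le]
    constructor <;> linarith [((hη 0).mem_Icc x).1, ((hη 0).mem_Icc x).2]
  set r : ℝ := (t / (2 * Cβ)) ^ (1 / β) with hr
  have hr0 : 0 < r := by positivity
  have hrR : r ≤ R := by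
    refine Real.rpow_le_rpow (by positivity) ?_ (by positivity)
    rw [div_le_div_iff₀ (by positivity) (by positivity)]
    have := mul_le_mul_of_nonneg_right ht1 (by positivity : 0 ≤ 4 * Cβ)
    linarith
  have hrβ : r ^ β = t / (2 * Cβ) := by
    rw [hr, ← Real.rpow_mul (by positivity), one_div_mul_cancel hβ.ne', Real.rpow_one]
  set A := c₀ * (1 / Cβ) ^ (d / β) / 4 * v ^ (d / β) with hA
  set q := c₀ * r ^ d with hq
  have hq4 : q = 4 * A * δ ^ (d / β) := by
    have : r ^ d = (1 / Cβ) ^ (d / β) * v ^ (d / β) * δ ^ (d / β) := by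
      rw [hr, hv, ← Real.rpow_natCast, ← Real.rpow_mul (by positivity),
        ← Real.mul_rpow (by positivity) (by positivity), ← Real.mul_rpow (by positivity) (by positivity)]
      congr 1
      · field_simp
      · ring
    rw [hq, hA, this]; ring
  set sg : ℝ := if 1 / 2 < η 0 x then 1 else -1 with hsgdef
  have hne : η 0 x ≠ 1 / 2 := fun h => by
    rw [ht, h] at ht0; simp at ht0
  have hsg : (sg = 1 ∧ 1 / 2 < η 0 x) ∨ (sg = -1 ∧ η 0 x < 1 / 2) := by
    rcases lt_or_gt_of_ne hne with h | h
    · exact Or.inr ⟨if_neg (by linarith), h⟩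
    · exact Or.inl ⟨if_pos h, h⟩
  have hsg' : sg = 1 ∨ sg = -1 := hsg.imp And.left And.left
  have hsgt : sg * (η 0 x - 1 / 2) = t := by
    rcases hsg with ⟨h1, h2⟩ | ⟨h1, h2⟩
    · rw [h1, ht, abs_of_pos (by linarith)]; ring
    · rw [h1, ht, abs_of_neg (by linarith)]; ring
  have hg : ∀ i, ∀ y ∈ Ω ∩ Metric.ball x r, c * (t / 2) ^ γ i ≤ sg * (η i y - 1 / 2) :=
    signal_near hβ hCβ hc hc1 hγ0 hγc hCγc hsmooth hsig hx ht0 hrβ hsg' hsgt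
  set k := fun i => numNeighbors d β γ n i with hk
  set w := fun i => weight d β γ n i with hw
  have hwδ : ∀ i, w i = δ ^ γ i := weight_eq hβ hγ hn
  have hw0 : ∀ i, 0 ≤ w i := fun i => by rw [hwδ]; positivity
  set S := ∑ i, w i ^ 2 * (k i : ℝ) with hS
  have hS2 : 1 / 2 ≤ S := half_le_sum_weight hβ hγ hn
  have hw1 : ∀ i, w i ≤ δ ^ c := fun i => by
    rw [hwδ]; exact Real.rpow_le_rpow_of_exponent_ge hδ0 hδ1 (hγc i)
  have hδc1 : δ ^ c ≤ 1 := Real.rpow_le_one hδ0.le hδ1 hc.le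
  -- Weights are at most `1`, so `w² ≤ w` and the denominator of `etaHat` is at least `S`.
  have hpos : 0 < ∑ i, w i * (k i : ℝ) := by
    refine lt_of_lt_of_le (by linarith : 0 < S) (Finset.sum_le_sum fun i _ => ?_)
    exact mul_le_mul_of_nonneg_right
      (pow_le_of_le_one (hw0 i) ((hw1 i).trans hδc1) two_ne_zero) (Nat.cast_nonneg _)
  set big := Finset.univ.filter fun i => L < k i with hbig
  have hDle : c / 2 * S * v ^ c ≤ ∑ i ∈ big, w i * k i * (c * (t / 2) ^ γ i) -
      1 / 2 * ∑ i ∈ bigᶜ, w i * (k i : ℝ) := by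
    have hwfun : w = fun i => δ ^ γ i := funext hwδ
    have ht2 : t / 2 = δ * v := by rw [hv]; ring
    rw [hS, hwfun] at hS2 ⊢
    rw [ht2]
    exact signal_lower hδ0 hδ1 hc hc1 hγc hv1 (by linarith) hS2 hL
  have hD0 : 0 ≤ c / 2 * S * v ^ c := by positivity
  have hball : ∀ i, ENNReal.ofReal q ≤ marginal (P i) (Metric.ball x r) := fun i =>
    hmass Ω _ (hdens i) x hx r hr0 hrR
  have hΩ : ∀ i, marginal (P i) Ωᶜ = 0 := fun i => by
    rw [← (hdens i).support_eq]; exact Measure.measure_compl_support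
  have hmain := measure_wrong_vote n hη hΩ hball (numNeighbors_le (d := d) hβ hγ hn) hw0 hsg' big hg
    hD0 hDle (measurableSet_wrong β γ n x (η 0 x)) (fun s hs => vote_of_disagree hpos hsg hs)
  refine hmain.trans ?_
  rw [← ENNReal.ofReal_sum_of_nonneg (fun _ _ => (Real.exp_pos _).le),
    ← ENNReal.ofReal_add (Real.exp_pos _).le (Finset.sum_nonneg fun _ _ => (Real.exp_pos _).le)]
  refine ENNReal.ofReal_le_ofReal (add_le_add (Real.exp_le_exp.2 ?_) ?_)
  · rw [neg_le_neg_iff]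
    change _ ≤ 2 * (c / 2 * S * v ^ c) ^ 2 / S
    have hS0 : 0 < S := by linarith
    have : 2 * (c / 2 * S * v ^ c) ^ 2 / S = c ^ 2 / 2 * S * v ^ (2 * c) := by
      rw [mul_comm 2 c, Real.rpow_mul (by positivity), Real.rpow_ofNat]
      field_simp
    rw [this]
    have h2 : c ^ 2 / 2 * (1 / 2) ≤ c ^ 2 / 2 * S := mul_le_mul_of_nonneg_left hS2 (by positivity)
    exact mul_le_mul_of_nonneg_right (by linarith) (by positivity)
  · calc ∑ i ∈ big, Real.exp (numNeighbors d β γ n i - n i * q / 2)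
        ≤ ∑ i ∈ big, Real.exp (-((L + 1) * A)) := by
          refine Finset.sum_le_sum fun i hi => Real.exp_le_exp.2 ?_
          have hi' : L + 1 ≤ k i := by simpa [hbig] using hi
          have hi'' : (L : ℝ) + 1 ≤ k i := by exact_mod_cast hi'
          have hkn : (k i : ℝ) ≤ n i * δ ^ (d / β) := numNeighbors_le_mul hβ hγ hn i
          change (k i : ℝ) - n i * q / 2 ≤ _
          rw [hq4]
          have hA1 : 1 ≤ A := hav
          -- The chain is `k_i - n_i q / 2 ≤ k_i - 2 A k_i ≤ -A k_i ≤ -(L + 1) A`, using `A ≥ 1`.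
          have h1 : (k i : ℝ) * A ≤ n i * δ ^ (d / β) * A :=
            mul_le_mul_of_nonneg_right hkn (zero_le_one.trans hA1)
          have h2 : ((L : ℝ) + 1) * A ≤ k i * A :=
            mul_le_mul_of_nonneg_right hi'' (zero_le_one.trans hA1)
          have h3 : (k i : ℝ) * 1 ≤ k i * A := mul_le_mul_of_nonneg_left hA1 (Nat.cast_nonneg _)
          linarith
      _ ≤ ∑ i : Fin (m + 1), Real.exp (-((L + 1) * A)) :=
          Finset.sum_le_sum_of_subset_of_nonneg (Finset.subset_univ _) fun _ _ _ =>
            (Real.exp_pos _).le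
      _ = (m + 1) * Real.exp (-((L + 1) * A)) := by simp

/-! ### Integration over the feature space -/

theorem exists_exp_neg_rpow_le {a p : ℝ} (ha : 0 < a) (hp : 0 < p) (q : ℝ) :
    ∃ C : ℝ, 0 < C ∧ ∀ v : ℝ, 1 ≤ v → Real.exp (-(a * v ^ p)) ≤ C * v ^ (-q) := by
  -- From `exp y ≥ y ^ N / N!`, with `N` so large that `(v ^ p) ^ N` dominates `v ^ q`.
  obtain ⟨N, hN⟩ := exists_nat_ge (q / p)
  refine ⟨N.factorial / a ^ N, by positivity, fun v hv => ?_⟩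
  have hv0 : 0 < v := by linarith
  have h1 := Real.pow_div_factorial_le_exp (a * v ^ p) (by positivity) N
  have h2 : v ^ q ≤ (v ^ p) ^ N := by
    rw [← Real.rpow_natCast, ← Real.rpow_mul hv0.le]
    refine Real.rpow_le_rpow_of_exponent_le hv ?_
    rwa [div_le_iff₀ hp, mul_comm] at hN
  rw [Real.exp_neg, Real.rpow_neg hv0.le, ← div_eq_mul_inv, inv_le_comm₀ (Real.exp_pos _)
    (by positivity)]
  refine le_trans ?_ h1
  rw [inv_div, div_div_eq_mul_div, mul_pow, mul_comm]
  gcongr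

instance {m : ℕ} (P : Fin (m + 1) → ProbabilityMeasure (Obs d)) (n : Fin (m + 1) → ℕ) :
    IsProbabilityMeasure (sampleLaw P n) := by
  unfold sampleLaw; infer_instance

theorem expectedExcessRisk_le {β : ℝ} {m : ℕ} {γ : Fin (m + 1) → ℝ} {n : Fin (m + 1) → ℕ}
    {P : Fin (m + 1) → ProbabilityMeasure (Obs d)} {η : Feature d → ℝ}
    (hη : IsRegressionFunction (P 0) η) :
    expectedExcessRisk β γ n P ≤ ∫⁻ x, ENNReal.ofReal (2 * |η x - 1 / 2|) *
      sampleLaw P n {s | Disagree (classifier β γ s x) (η x)} ∂(marginal (P 0)) := by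
  have hηm := hη.measurable
  have hjoint : MeasurableSet {z : Sample d n × Feature d |
      Disagree (classifier β γ z.1 z.2) (η z.2)} :=
    measurableSet_disagree (measurable_classifier β γ n) (hηm.comp measurable_snd)
  have hfm : Measurable fun x => ENNReal.ofReal (2 * |η x - 1 / 2|) :=
    (Measurable.const_mul (measurable_norm.comp (hηm.sub_const _)) _).ennreal_ofReal
  calc expectedExcessRisk β γ n P
      ≤ ∫⁻ s, ∫⁻ x, {z : Sample d n × Feature d | Disagree (classifier β γ z.1 z.2) (η z.2)}.indicator
          (fun z => ENNReal.ofReal (2 * |η z.2 - 1 / 2|)) (s, x) ∂(marginal (P 0))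
          ∂(sampleLaw P n) :=
        lintegral_mono fun s => hη.excessRisk_le (measurable_classifier β γ n).of_uncurry_left
    _ = ∫⁻ x, ∫⁻ s, {z : Sample d n × Feature d | Disagree (classifier β γ z.1 z.2) (η z.2)}.indicator
          (fun z => ENNReal.ofReal (2 * |η z.2 - 1 / 2|)) (s, x) ∂(sampleLaw P n)
          ∂(marginal (P 0)) :=
        lintegral_lintegral_swap ((hfm.comp measurable_snd).indicator hjoint).aemeasurable
    _ = _ := by
        refine lintegral_congr fun x => ?_
        rw [← lintegral_indicator_const (measurableSet_wrong β γ n x (η x))]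
        rfl

/-- Integrating a tail bound against the margin condition. -/
theorem lintegral_margin_le {E : Type*} [MeasurableSpace E] {μ : Measure E} {f : E → ℝ}
    (hf : Measurable f) {α Cα s H : ℝ} (hα : 0 ≤ α) (hCα : 0 < Cα)
    (hs : 0 < s) (hH : 1 ≤ H)
    (hmargin : ∀ t : ℝ, 0 < t → μ {x | f x ≤ t} ≤ ENNReal.ofReal (Cα * t ^ α))
    {ψ : E → ℝ≥0∞} (hψ1 : ∀ x, ψ x ≤ 1)
    (hψ : ∀ᵐ x ∂μ, s ≤ f x → ψ x ≤ ENNReal.ofReal (H * (f x / s) ^ (-(α + 2)))) :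
    ∫⁻ x, ENNReal.ofReal (2 * f x) * ψ x ∂μ ≤
      ENNReal.ofReal (4 * H * 2 ^ (1 + α) * Cα * s ^ (1 + α)) := by
  set b : ℝ := 2 * H * s * 2 ^ (1 + α) with hb
  have hb0 : 0 < b := by positivity
  -- Dyadic decomposition: term `0` covers `f ≤ s`, term `j + 1` covers `2 ^ j s ≤ f < 2 ^ (j + 1)
  -- s`. Of the `α + 2` powers of decay, `f` itself uses one and the margin condition `α`; the last
  -- one gives a geometric series.
  have hpt : ∀ᵐ x ∂μ, ENNReal.ofReal (2 * f x) * ψ x ≤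
      ∑' j : ℕ, {x | f x ≤ 2 ^ j * s}.indicator
        (fun _ => ENNReal.ofReal (b * ((2 : ℝ) ^ j) ^ (-(1 + α)))) x := by
    filter_upwards [hψ] with x hx
    rcases le_or_gt (f x) s with h | h
    · refine le_trans ?_ (ENNReal.le_tsum 0)
      rw [indicator_of_mem (by simpa using h)]
      refine (mul_le_of_le_one_right zero_le (hψ1 x)).trans (ENNReal.ofReal_le_ofReal ?_)
      rw [pow_zero, Real.one_rpow, mul_one, hb]
      have h2 : (1 : ℝ) ≤ 2 ^ (1 + α) := Real.one_le_rpow (by norm_num) (by linarith)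
      calc 2 * f x ≤ 2 * 1 * s * 1 := by linarith
        _ ≤ 2 * H * s * 2 ^ (1 + α) := by gcongr
    · have hy : 1 ≤ f x / s := by rw [le_div_iff₀ hs]; linarith
      obtain ⟨j, hj1, hj2⟩ := exists_nat_pow_near hy (one_lt_two (α := ℝ))
      refine le_trans ?_ (ENNReal.le_tsum (j + 1))
      rw [indicator_of_mem (by rw [mem_ofPred_eq, ← div_le_iff₀ hs]; exact hj2.le)]
      refine (mul_le_mul_right (hx h.le) _).trans ?_
      rw [← ENNReal.ofReal_mul (by linarith)]
      refine ENNReal.ofReal_le_ofReal ?_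
      have hfx : f x = s * (f x / s) := by field_simp
      set y := f x / s with hydef
      have hy0 : 0 < y := by linarith
      rw [hfx]
      have e1 : y * y ^ (-(α + 2)) = y ^ (-(1 + α)) := by
        rw [← Real.rpow_one_add' hy0.le (by linarith)]; congr 1; ring
      have e2 : y ^ (-(1 + α)) ≤ ((2 : ℝ) ^ j) ^ (-(1 + α)) :=
        Real.rpow_le_rpow_of_nonpos (by positivity) hj1 (by linarith)
      have e3 : (2 : ℝ) ^ (1 + α) * ((2 : ℝ) ^ (j + 1)) ^ (-(1 + α)) =
          ((2 : ℝ) ^ j) ^ (-(1 + α)) := by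
        rw [pow_succ, Real.mul_rpow (by positivity) (by positivity), mul_left_comm,
          ← Real.rpow_add two_pos]
        simp
      calc 2 * (s * y) * (H * y ^ (-(α + 2))) = 2 * H * s * (y * y ^ (-(α + 2))) := by ring
        _ ≤ 2 * H * s * ((2 : ℝ) ^ j) ^ (-(1 + α)) := by rw [e1]; gcongr
        _ = b * ((2 : ℝ) ^ (j + 1)) ^ (-(1 + α)) := by rw [← e3, hb]; ring
  have hms : ∀ t : ℝ, MeasurableSet {x | f x ≤ t} := fun t => measurableSet_le hf measurable_const
  refine (lintegral_mono_ae hpt).trans ?_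
  rw [lintegral_tsum fun j => (measurable_const.indicator (hms _)).aemeasurable]
  calc ∑' j : ℕ, ∫⁻ x, {x | f x ≤ 2 ^ j * s}.indicator
        (fun _ => ENNReal.ofReal (b * ((2 : ℝ) ^ j) ^ (-(1 + α)))) x ∂μ
      ≤ ∑' j : ℕ, ENNReal.ofReal (b * Cα * s ^ α * (1 / 2) ^ j) := by
        refine ENNReal.tsum_le_tsum fun j => ?_
        rw [lintegral_indicator_const (hms _)]
        refine (mul_le_mul_right (hmargin _ (by positivity)) _).trans ?_
        rw [← ENNReal.ofReal_mul (by positivity)]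
        refine ENNReal.ofReal_le_ofReal (le_of_eq ?_)
        have h2j : (0 : ℝ) < 2 ^ j := by positivity
        have : ((2 : ℝ) ^ j) ^ (-(1 + α)) * ((2 : ℝ) ^ j) ^ α = (1 / 2) ^ j := by
          rw [← Real.rpow_add h2j, show -(1 + α) + α = -1 by ring, Real.rpow_neg_one, one_div,
            inv_pow]
        rw [Real.mul_rpow h2j.le hs.le, ← this]
        ring
    _ = ENNReal.ofReal (b * Cα * s ^ α * 2) := by
        rw [← ENNReal.ofReal_tsum_of_nonneg (fun _ => by positivity)
          (summable_geometric_two.mul_left _), tsum_mul_left, tsum_geometric_two]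
    _ = _ := by
        rw [Real.rpow_add hs, Real.rpow_one, hb]; congr 1; ring

/-- The risk bound, with the union bound over the data sets with more than `L` neighbours entering
only through the constant `B`. -/
theorem exists_risk_bound {α Cα β Cβ μlo μhi cμ rμ c B : ℝ} (hd : 1 ≤ d) (hα : 0 ≤ α)
    (hCα : 0 < Cα) (hβ : 0 < β) (hCβ : 0 < Cβ) (hμlo : 0 < μlo) (hcμ : 0 < cμ) (hrμ : 0 < rμ)
    (hc : 0 < c) (hc1 : c ≤ 1) (hB : 0 < B) :
    ∃ C : ℝ, 0 < C ∧ ∀ {m : ℕ} {γ Cγ : Fin (m + 1) → ℝ}, γ 0 = 1 →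
      (∀ i, c ≤ γ i) → (∀ i, c ≤ Cγ i) → ∀ {n : Fin (m + 1) → ℕ}, (∀ i, 1 ≤ n i) → ∀ {L : ℕ},
      (m + 1) * L * rate d β γ n ^ c ≤ c / 6 →
      (∀ y : ℝ, 1 ≤ y → (m + 1) * Real.exp (-((L + 1) * y)) ≤ B * Real.exp (-y)) →
      ⨆ P ∈ distClass (d := d) α Cα β Cβ μlo μhi cμ rμ γ Cγ, expectedExcessRisk β γ n P ≤
        ENNReal.ofReal (C * maxEff d β γ n ^ (-(β * (1 + α) / (2 * β + d)))) := by
  obtain ⟨a, ha, hpt⟩ := exists_pointwise_bound (d := d) (μhi := μhi) hβ hCβ hμlo hcμ hrμ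
  have hdβ : 0 < (d : ℝ) / β := by
    have : (0 : ℝ) < d := by exact_mod_cast hd
    positivity
  obtain ⟨C₁, hC₁, hexp₁⟩ := exists_exp_neg_rpow_le (a := c ^ 2 / 4) (p := 2 * c) (by positivity)
    (by positivity) (α + 2)
  obtain ⟨C₂, hC₂, hexp₂⟩ := exists_exp_neg_rpow_le ha hdβ (α + 2)
  -- From `v = K` on, the quantity `a v ^ (d / β)` is at least `1`, as the pointwise bound needs.
  -- Below this, probabilities are bounded by `1`, so the integration starts at level `2 K δ`.
  set K : ℝ := max 1 ((1 / a) ^ (1 / (d / β))) with hK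
  have hK1 : 1 ≤ K := le_max_left _ _
  have hKa : ∀ v, K ≤ v → 1 ≤ a * v ^ ((d : ℝ) / β) := by
    intro v hv
    have h1 : (1 / a) ^ (1 / ((d : ℝ) / β)) ≤ v := (le_max_right _ _).trans hv
    have h2 : ((1 / a) ^ (1 / ((d : ℝ) / β))) ^ ((d : ℝ) / β) ≤ v ^ ((d : ℝ) / β) :=
      Real.rpow_le_rpow (by positivity) h1 hdβ.le
    rw [← Real.rpow_mul (by positivity), one_div_mul_cancel hdβ.ne', Real.rpow_one,
      div_le_iff₀ ha] at h2
    linarith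
  set H : ℝ := max 1 (C₁ + B * C₂) with hH
  refine ⟨4 * H * 2 ^ (1 + α) * Cα * (2 * K) ^ (1 + α), by positivity, ?_⟩
  intro m γ Cγ hγ0 hγc hCγc n hn L hL hLB
  have hγ : ∀ i, 0 < γ i := fun i => hc.trans_le (hγc i)
  refine iSup₂_le fun P hP => ?_
  obtain ⟨η, Ω, hη, hdens, hsmooth, hmargin, hsig⟩ := hP
  set δ := rate d β γ n with hδ
  have hδ0 : 0 < δ := rate_pos hβ hγ hn
  have hη0 := (hη 0).measurable
  have hΩ : ∀ᵐ x ∂(marginal (P 0)), x ∈ Ω := by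
    rw [← (hdens 0).support_eq]; exact Measure.support_mem_ae
  refine (expectedExcessRisk_le (hη 0)).trans ?_
  refine (lintegral_margin_le (s := 2 * K * δ) (H := H) (measurable_norm.comp (hη0.sub_const _))
    hα hCα (by positivity) (le_max_left _ _) hmargin
    (fun x => prob_le_one) ?_).trans (le_of_eq ?_)
  · filter_upwards [hΩ] with x hx hsx
    change 2 * K * δ ≤ |η 0 x - 1 / 2| at hsx
    change _ ≤ ENNReal.ofReal (H * (|η 0 x - 1 / 2| / (2 * K * δ)) ^ (-(α + 2)))
    set v := |η 0 x - 1 / 2| / (2 * δ) with hv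
    have htv : |η 0 x - 1 / 2| = 2 * δ * v := by rw [hv]; field_simp
    have hKv : K ≤ v := by
      rw [hv, le_div_iff₀ (by positivity)]; linarith
    have hv1 : 1 ≤ v := hK1.trans hKv
    have hav := hKa v hKv
    refine (hpt hc hc1 hγ0 hγc hCγc hn hL hη hdens hsmooth hsig x hx htv hv1 hav).trans
      (ENNReal.ofReal_le_ofReal ?_)
    have hvK : |η 0 x - 1 / 2| / (2 * K * δ) = v / K := by rw [hv]; field_simp
    rw [hvK]
    have hmono : v ^ (-(α + 2)) ≤ (v / K) ^ (-(α + 2)) :=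
      Real.rpow_le_rpow_of_nonpos (by positivity) (div_le_self (by positivity) hK1) (by linarith)
    calc Real.exp (-(c ^ 2 / 4 * v ^ (2 * c))) +
          (m + 1) * Real.exp (-((L + 1) * (a * v ^ ((d : ℝ) / β))))
        ≤ C₁ * v ^ (-(α + 2)) + B * (C₂ * v ^ (-(α + 2))) :=
          add_le_add (hexp₁ v hv1) ((hLB _ hav).trans
            (mul_le_mul_of_nonneg_left (hexp₂ v hv1) hB.le))
      _ = (C₁ + B * C₂) * v ^ (-(α + 2)) := by ring
      _ ≤ H * (v / K) ^ (-(α + 2)) :=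
          mul_le_mul (le_max_right _ _) hmono (by positivity) (by positivity)
  · rw [Real.mul_rpow (by positivity) hδ0.le, hδ, rate_rpow hβ hγ hn]
    congr 1; ring

/-- The threshold is uniform in `γ` because `δ` is bounded through `n 0` alone, with an exponent
free of the `γ i`. -/
theorem exists_sample_size {β κ c : ℝ} (hβ : 0 < β) (hc : 0 < c) (hκ : 0 < κ) (m : ℕ) :
    ∃ N : ℕ, 1 ≤ N ∧ ∀ (γ : Fin (m + 1) → ℝ) (n : Fin (m + 1) → ℕ), γ 0 = 1 → (∀ i, 0 < γ i) →
      (∀ i, N ≤ n i) → (m + 1) * (m : ℕ) * rate d β γ n ^ c ≤ κ := by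
  set e := β / (2 * β + d) * c with he
  have he0 : 0 < e := by positivity
  have hlim : Filter.Tendsto (fun N : ℕ => ((m : ℝ) + 1) * m * (N : ℝ) ^ (-e)) Filter.atTop
      (nhds (((m : ℝ) + 1) * m * 0)) :=
    ((tendsto_rpow_neg_atTop he0).comp tendsto_natCast_atTop_atTop).const_mul _
  rw [mul_zero] at hlim
  obtain ⟨N, hN⟩ := Filter.eventually_atTop.1 (hlim.eventually_le_const hκ)
  refine ⟨max 1 N, le_max_left _ _, fun γ n hγ0 hγ hn => ?_⟩
  have hn1 : ∀ i, 1 ≤ n i := fun i => (le_max_left _ _).trans (hn i)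
  refine le_trans ?_ (hN (n 0) ((le_max_right _ _).trans (hn 0)))
  have h1 : rate d β γ n ^ c ≤ ((n 0 : ℝ) ^ (-(β / (2 * β + d)))) ^ c :=
    Real.rpow_le_rpow (rate_pos hβ hγ hn1).le (rate_le_of_le hβ hγ0 hn1) hc.le
  rw [← Real.rpow_mul (Nat.cast_nonneg _), neg_mul] at h1
  gcongr

end VSNN

/-! ### The two choices of the cutoff -/

theorem mainTheorem10 (d : ℕ) (hd : 1 ≤ d)
    (α Cα β Cβ μlo μhi cμ rμ : ℝ)
    (hα : 0 ≤ α) (hCα : 0 < Cα) (hβ : 0 < β) (hCβ : 0 < Cβ)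
    (hμlo : 0 < μlo) (hμhi : μlo < μhi) (hcμ : 0 < cμ) (hrμ : 0 < rμ)
    (γ Cγ : ℕ → ℝ) (hγ0 : γ 0 = 1) (hγ : ∀ i, 0 < γ i) (hCγ : ∀ i, 0 < Cγ i) :
    -- for every number `m` of workers, a constant not depending on the `n_i`
    (∀ m : ℕ, ∃ C : ℝ, 0 < C ∧ ∀ n : Fin (m + 1) → ℕ, (∀ i, 1 ≤ n i) →
      (⨆ P ∈ VSNN.distClass (d := d) α Cα β Cβ μlo μhi cμ rμ
          (fun i : Fin (m + 1) => γ i) (fun i : Fin (m + 1) => Cγ i),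
        VSNN.expectedExcessRisk β (fun i : Fin (m + 1) => γ i) n P)
      ≤ ENNReal.ofReal (C *
          VSNN.maxEff d β (fun i : Fin (m + 1) => γ i) n ^ (-(β * (1 + α) / (2 * β + d))))) ∧
    -- if the `γ_i` and `C_{γ_i}` are bounded away from zero, a constant not depending on the
    -- `n_i` and `m`, once the `n_i` are large
    ((∃ c : ℝ, 0 < c ∧ ∀ i, c ≤ γ i ∧ c ≤ Cγ i) →
      ∃ C : ℝ, 0 < C ∧ ∀ m : ℕ, ∃ N : ℕ, ∀ n : Fin (m + 1) → ℕ, (∀ i, N ≤ n i) →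
        (⨆ P ∈ VSNN.distClass (d := d) α Cα β Cβ μlo μhi cμ rμ
            (fun i : Fin (m + 1) => γ i) (fun i : Fin (m + 1) => Cγ i),
          VSNN.expectedExcessRisk β (fun i : Fin (m + 1) => γ i) n P)
        ≤ ENNReal.ofReal (C *
            VSNN.maxEff d β (fun i : Fin (m + 1) => γ i) n ^ (-(β * (1 + α) / (2 * β + d))))) := by
  constructor
  · intro m
    set c : ℝ := min 1 (Finset.univ.inf' Finset.univ_nonempty
      fun i : Fin (m + 1) => min (γ i) (Cγ i)) with hcdef
    have hc : 0 < c := by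
      refine lt_min one_pos ((Finset.lt_inf'_iff _).2 fun i _ => lt_min (hγ i) (hCγ i))
    have hcle : ∀ i : Fin (m + 1), c ≤ min (γ i) (Cγ i) := fun i =>
      (min_le_right _ _).trans (Finset.inf'_le _ (Finset.mem_univ i))
    -- Cutoff `L = 0`: the smallness condition is void, and `B = m + 1` is the price of the union
    -- bound.
    obtain ⟨C, hC, h⟩ := VSNN.exists_risk_bound (d := d) (μhi := μhi) (B := m + 1) hd hα hCα hβ hCβ
      hμlo hcμ hrμ hc (min_le_left _ _) (by positivity)
    refine ⟨C, hC, fun n hn => h (L := 0) hγ0 (fun i => (hcle i).trans (min_le_left _ _))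
      (fun i => (hcle i).trans (min_le_right _ _)) hn ?_ fun y _ => ?_⟩
    · simp only [Nat.cast_zero, mul_zero, zero_mul]; positivity
    · simp
  · rintro ⟨c, hc, hle⟩
    have hc' : 0 < min 1 c := lt_min one_pos hc
    obtain ⟨C, hC, h⟩ := VSNN.exists_risk_bound (d := d) (μhi := μhi) (B := 1) hd hα hCα hβ hCβ
      hμlo hcμ hrμ hc' (min_le_left _ _) one_pos
    refine ⟨C, hC, fun m => ?_⟩
    obtain ⟨N, hN1, hN⟩ := VSNN.exists_sample_size (d := d) (κ := min 1 c / 6) hβ hc'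
      (by positivity) m
    -- Cutoff `L = m`: since `m + 1 ≤ exp m ≤ exp (m y)` for `y ≥ 1`, the union bound is absorbed
    -- and `B = 1` does for every `m`.
    refine ⟨N, fun n hn => h (L := m) hγ0 (fun i => (min_le_right _ _).trans (hle i).1)
      (fun i => (min_le_right _ _).trans (hle i).2) (fun i => hN1.trans (hn i))
      (hN _ n hγ0 (fun i => hγ i) hn) fun y hy => ?_⟩
    have h1 : (m : ℝ) + 1 ≤ Real.exp (m * y) :=
      (Real.add_one_le_exp (m : ℝ)).trans (Real.exp_le_exp.2
        (le_mul_of_one_le_right (Nat.cast_nonneg _) hy))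
    calc ((m : ℝ) + 1) * Real.exp (-((m + 1) * y))
        ≤ Real.exp (m * y) * Real.exp (-((m + 1) * y)) := by gcongr
      _ = 1 * Real.exp (-y) := by rw [← Real.exp_add, one_mul]; congr 1; ring
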